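/- Let $d\ge 1$, let $\mathbb{B}^d$ be the open unit ball of $\mathbb{C}^d$ and let $\sigma$ be the normalised rotation-invariant Lebesgue measure on the unit sphere $\partial\mathbb{B}^d$. For a bounded holomorphic $g:\mathbb{B}^d\to\mathbb{C}$ and $\zeta\in\partial\mathbb{B}^d$ let $g(\zeta)$ denote the $K$-limit of $g$ at $\zeta$, i.e. the limit of $g(z)$ as $z\to\zeta$ within each Korányi region $\{z\in\mathbb{B}^d : |1-\langle z,\zeta\rangle|<\tfrac a2(1-\|z\|^2)\}$, $a>1$; it exists for $\sigma$-a.e. $\zeta$. For a finite positive measure $\mu$ on $\partial\mathbb{B}^d$ let $K(\alpha,\beta)=\int\zeta^\alpha\overline{\zeta}^{\beta}\,d\mu(\zeta)$, $\alpha,\beta\in\mathbb{N}_0^d$, be its moment kernel, and order $\mathbb{N}_0^d$ by the short lexicographical ordering with $e_1\prec\dots\prec e_d$, so that $K$ becomes a positive kernel on $\mathbb{N}_0$. The Verblunsky coefficients $\gamma_{\alpha,\beta}$ ($\alpha\preceq\beta$) of $\mu$ are the Schur parameters $\gamma_{k,j}$ of this kernel in the sense of Constantinescu: $\gamma_{k,k}=0$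 and, for $k<j$, with $d_{n,m}=\sqrt{1-|\gamma_{n,m}|^2}$, $$K(k,j)=\sqrt{K(k,k)K(j,j)}\,\Big(R_{k,j-1}U_{k+1,j-1}C_{k+1,j}+\Big(\prod_{k<m<j}d_{k,m}\Big)\gamma_{k,j}\Big(\prod_{k<m<j}d_{m,j}\Big)\Big)$$ (with $\gamma_{k,j}=0$ if one of the factors multiplying it vanishes). Here $R_{k,j-1}$ is the row with entries $\big(\prod_{k<m<n}d_{k,m}\big)\gamma_{k,n}$, $n=k+1,\dots,j-1$; $C_{k+1,j}$ is the column with entries $\gamma_{n,j}\prod_{n<m<j}d_{m,j}$, $n=j-1,\dots,k+1$; and the unitary matrices $U_{k,j}$ of size $j-k+1$ are given by $U_{k,k}=1$ and $U_{k,j}=G_{k,k+1}\cdots G_{k,j}(U_{k+1,j}\oplus 1)$, where $G_{k,k+l}$ acts as $\begin{pmatrix}\gamma_{k,k+l}&d_{k,k+l}\\ d_{k,k+l}&-\overline{\gamma_{k,k+l}}\end{pmatrix}$ on the coordinates $l,l+1$ and as the identity on the others. (The term with $R$, $U$, $C$ is absent when $j=k+1$.) **Theorem.** Let $g$ be a bounded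 holomorphic function on $\mathbb{B}^d$ with $\|g\|_\infty\le 1$ and $\operatorname{Re} g(z)\ge 0$ for all $z\in\mathbb{B}^d$, and suppose that there is $\varepsilon>0$ such that $w(\zeta):=|g(\zeta)|^2\ge\varepsilon$ for $\sigma$-a.e. $\zeta\in\partial\mathbb{B}^d$. Let $\mu_{\mathrm s}$ be a discrete measure on $\partial\mathbb{B}^d$ (one carried by a countable set) such that $d\mu=w\,d\sigma+d\mu_{\mathrm s}$ is a probability measure, and let $(\gamma_{\alpha,\beta})$ be the Verblunsky coefficients of $\mu$. Then $\log w\in L^1(\sigma)$ and $$\prod_{\alpha\in\mathbb{N}_0^d}\big(1-|\gamma_{0,\alpha}|^2\big)=\exp\Big(\int_{\partial\mathbb{B}^d}\log w\,d\sigma\Big)>0,$$ where the product converges (unconditionally). -/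

import Mathlib

open MeasureTheory Filter Topology Metric
open scoped ENNReal ComplexConjugate

noncomputable section

/-- `ℂ^d` with its Euclidean norm and the Hermitian inner product
`⟨z, ζ⟩ = ∑ j, z j * conj (ζ j)`, written `inner ℂ ζ z` in Mathlib. -/
abbrev Cn (d : ℕ) : Type := EuclideanSpace ℂ (Fin d)

/-- The unit sphere `∂𝔹^d` of `ℂ^d`. -/
abbrev USphere (d : ℕ) : Type := sphere (0 : Cn d) 1

/-- The normalised rotation-invariant surface measure `σ` on the unit sphere. -/
def sigma (d : ℕ) : Measure (USphere d) :=
  ((volume : Measure (Cn d)).toSphere Set.univ)⁻¹ • (volume : Measure (Cn d)).toSphere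

/-! ### Boundary values of functions on the ball -/

/-- Korányi approach region of aperture `a` at the boundary point `ζ`. -/
def koranyiRegion {d : ℕ} (a : ℝ) (ζ : USphere d) : Set (Cn d) :=
  {z | z ∈ ball (0 : Cn d) 1 ∧ ‖1 - inner ℂ (ζ : Cn d) z‖ < a / 2 * (1 - ‖z‖ ^ 2)}

/-- `g` has `K`-limit `c` at `ζ`: `g z → c` as `z → ζ` within each Korányi region at `ζ`. -/
def HasKLimit {d : ℕ} (g : Cn d → ℂ) (ζ : USphere d) (c : ℂ) : Prop :=
  ∀ a : ℝ, 1 < a → Tendsto g (𝓝[koranyiRegion a ζ] (ζ : Cn d)) (𝓝 c)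

open Classical in
/-- The boundary function of `g`: its `K`-limit at every point where that limit exists
(and `0` at the other points, a `σ`-null set when `g` is bounded and holomorphic). -/
def boundaryValue {d : ℕ} (g : Cn d → ℂ) (ζ : USphere d) : ℂ :=
  if h : ∃ c, HasKLimit g ζ c then h.choose else 0

/-! ### Measures and moments -/

/-- A discrete (pure point) measure: it is carried by a countable set of points. -/
def IsDiscreteMeasure {X : Type*} [MeasurableSpace X] (μ : Measure X) : Prop :=
  ∃ S : Set X, S.Countable ∧ μ Sᶜ = 0

/-- The moment kernel `K(α, β) = ∫ ζ^α conj(ζ^β) dμ(ζ)`. -/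
def momentKernel {d : ℕ} (μ : Measure (USphere d)) (α β : Fin d → ℕ) : ℂ :=
  ∫ ζ : USphere d, (∏ i, (ζ : Cn d) i ^ α i) * conj (∏ i, (ζ : Cn d) i ^ β i) ∂μ

/-! ### The short lexicographical ordering of multi-indices -/

/-- `α ≺ β`: smaller length first; among multi-indices of equal length the one with the larger
entry at the first place of difference comes first, so `e_1 ≺ e_2 ≺ … ≺ e_d` and
`(2,0) ≺ (1,1) ≺ (0,2)`. -/
def ShortlexLT {d : ℕ} (α β : Fin d → ℕ) : Prop :=
  ∑ i, α i < ∑ i, β i ∨ (∑ i, α i = ∑ i, β i ∧ toLex β < toLex α)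

/-- The position (counted from `0`) of a multi-index in the shortlex ordering. -/
def shortlexPos {d : ℕ} (α : Fin d → ℕ) : ℕ :=
  {β : Fin d → ℕ | ShortlexLT β α}.ncard

/-- The multi-index at position `n` of the shortlex ordering (for `1 ≤ d`). -/
def shortlexNth (d : ℕ) : ℕ → (Fin d → ℕ) :=
  Function.invFun (shortlexPos (d := d))

/-! ### Schur parameters of a positive kernel on `ℕ`

Constantinescu's parametrisation, for scalar kernels. A positive kernel `K` corresponds to its
diagonal together with numbers `γ k j` (`k < j`) in the closed unit disc through
`K k j = √(K k k) * (R * U * C + (∏ m, d (γ k m)) * γ k j * (∏ m, d (γ m j))) * √(K j j)`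
(`m` running over `k < m < j`), where `d c = √(1 - |c|²)`, `R` is the row with entries
`(∏ k < m < n, d (γ k m)) * γ k n` for `n = k+1, …, j-1`, `C` is the column with entries
`γ n j * (∏ n < m < j, d (γ m j))` for `n = j-1, …, k+1`, and `U = U_{k+1,j-1}` is the unitary
matrix with `U_{k,k} = 1` and `U_{k,j} = G_{k,k+1} ⋯ G_{k,j} (U_{k+1,j} ⊕ 1)`, the factor
`G_{k,k+l}` being the elementary rotation of `γ k (k+l)` on the coordinates `l`, `l+1`.
Vectors are written as sequences, of which only the first few coordinates matter. -/

/-- The defect `d(c) = √(1 - |c|²)`. -/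
def defect (c : ℂ) : ℝ := Real.sqrt (1 - ‖c‖ ^ 2)

/-- The elementary rotation `[c, d(c); d(c), -conj c]` on the coordinates `l`, `l+1`. -/
def elemRotation (l : ℕ) (c : ℂ) (x : ℕ → ℂ) : ℕ → ℂ := fun i =>
  if i = l then c * x l + defect c * x (l + 1)
  else if i = l + 1 then defect c * x l - conj c * x (l + 1)
  else x i

/-- The product `G_{k,k+1} G_{k,k+2} ⋯ G_{k,k+m}` applied to `x`. -/
def rotationChain (γ : ℕ → ℕ → ℂ) (k : ℕ) : ℕ → (ℕ → ℂ) → (ℕ → ℂ)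
  | 0, x => x
  | m + 1, x => rotationChain γ k m (elemRotation m (γ k (k + m + 1)) x)

/-- The unitary `U_{k,k+n}` of size `n + 1` applied to `x`. -/
def generalRotation (γ : ℕ → ℕ → ℂ) : ℕ → ℕ → (ℕ → ℂ) → (ℕ → ℂ)
  | _, 0, x => x
  | k, n + 1, x => rotationChain γ k (n + 1) (generalRotation γ (k + 1) n x)

/-- The entries of the row `R`. -/
def schurRow (γ : ℕ → ℕ → ℂ) (k i : ℕ) : ℂ :=
  (∏ m ∈ Finset.Ioo k (k + 1 + i), (defect (γ k m) : ℂ)) * γ k (k + 1 + i)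

/-- The entries of the column `C` (of length `j - 1 - k`). -/
def schurCol (γ : ℕ → ℕ → ℂ) (k j i : ℕ) : ℂ :=
  if i < j - 1 - k then
    γ (j - 1 - i) j * ∏ m ∈ Finset.Ioo (j - 1 - i) j, (defect (γ m j) : ℂ)
  else 0

/-- The scalar `R * U * C` of the pair `k < j`. -/
def schurCorner (γ : ℕ → ℕ → ℂ) (k j : ℕ) : ℂ :=
  ∑ i ∈ Finset.range (j - 1 - k),
    schurRow γ k i * generalRotation γ (k + 1) (j - k - 2) (schurCol γ k j) i

/-- The displayed formula for `K k j`, solved for `γ k j`. (If a defect vanishes, then division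
by zero returns the value `0` that the parametrisation prescribes in this case.) -/
def schurSolve (K γ : ℕ → ℕ → ℂ) (k j : ℕ) : ℂ :=
  (K k j / (Real.sqrt (K k k).re * Real.sqrt (K j j).re : ℝ) - schurCorner γ k j) /
    ((∏ m ∈ Finset.Ioo k j, (defect (γ k m) : ℂ)) *
      ∏ m ∈ Finset.Ioo k j, (defect (γ m j) : ℂ))

/-- The Schur parameters `γ k j` with `j - k ≤ l`, computed diagonal by diagonal. -/
def schurTable (K : ℕ → ℕ → ℂ) : ℕ → ℕ → ℕ → ℂ
  | 0 => fun _ _ => 0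
  | l + 1 => fun k j =>
      if j = k + (l + 1) then schurSolve K (schurTable K l) k j else schurTable K l k j

/-- The Schur parameters `γ k j`, `k ≤ j`, of the positive kernel `K`, with `γ k k = 0`. -/
def schurParam (K : ℕ → ℕ → ℂ) (k j : ℕ) : ℂ := schurTable K (j - k) k j

/-- The Verblunsky coefficients `γ_{α,β}` (`α ≼ β`) of a measure on the sphere: the Schur
parameters of its moment kernel, transported to `ℕ` by the shortlex ordering. -/
def verblunsky {d : ℕ} (μ : Measure (USphere d)) (α β : Fin d → ℕ) : ℂ :=
  schurParam (fun n m => momentKernel μ (shortlexNth d n) (shortlexNth d m))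
    (shortlexPos α) (shortlexPos β)

end

/-! The product is a distance in `L²(μ)`. The conjugates of the monomials, normalised, are unit
vectors whose Gram kernel is the normalised moment kernel. For such a kernel the Schur parameter
`γ_{k,j}` is the partial correlation of the vectors `k` and `j` once the vectors strictly between
them are projected away (`schurParam_eq_partialCorrelation`). Constantinescu's formula is the
expansion of `⟨v_k, v_j⟩` in the residuals of the Levinson recursion, and the unitary matrices `U`
are the changes of coordinates from backward to forward residuals. Each Levinson step multiplies the
squared length of the residual of `v_0` by `1 - |γ_{0,m}|²`. Hence the partial products are squared
distances of `1` from the span of the next monomials, and the infinite product is the infimum of `∫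
|1 + p|² dμ` over polynomials `p` without constant term (`hasProd_verblunsky`). The bound `w ≥ ε`
makes `σ` absolutely continuous with respect to `μ`; the monomials are then linearly independent and
no defect vanishes.

This infimum is `|g(0)|²`. For the lower bound (`sq_norm_le_integral`), drop the singular part and
apply the mean value property and Cauchy–Schwarz to `(1 + p) g`, whose value at the origin is
`g(0)`. For the upper bound (`exists_polynomial_integral_lt`), use `(g(0) + δ) / (g(r z) + δ)`: it
equals `1` at the origin, and as `r → 1` its modulus times `|g|` becomes at most `|g(0) + δ|`, since
`|g| ≤ |g + δ|` when `Re g ≥ 0`. Multiplying by polynomials that equal `1` at `0`, vanish at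
finitely many atoms of the singular part and tend boundedly to `1` elsewhere removes almost all of
that part and costs nothing in the limit against `σ`, which has no atoms. The result is holomorphic
beyond the closed ball, so it may be replaced by a polynomial.

Finally `g` is outer: `log (g + δ)` is bounded and holomorphic because `Re g ≥ 0`, so the mean of
`log |g + δ|` is `log |g(0) + δ|`. Letting `δ → 0` gives `exp ∫ log w dσ = |g(0)|²`
(`exp_integral_log_norm`). -/

noncomputable section

/-! ### Schur parameters of a Gram kernel -/

section SchurParameters

variable {E : Type*} [NormedAddCommGroup E] [InnerProductSpace ℂ E]

/-- The normalised forward and backward residuals of the vectors `v k, …, v (k + n)`, computed by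
the Levinson recursion. -/
def levinson (v : ℕ → E) : ℕ → ℕ → E × E
  | k, 0 => (v k, v k)
  | k, n + 1 =>
    let φ := (levinson v (k + 1) n).1
    let ψ := (levinson v k n).2
    let c : ℂ := inner ℂ ψ φ
    ((defect c : ℂ)⁻¹ • (φ - c • ψ), (defect c : ℂ)⁻¹ • (ψ - conj c • φ))

/-- The normalised residual of `v (k + n)` modulo its predecessors down to `v k`. -/
def forwardResidual (v : ℕ → E) (k n : ℕ) : E := (levinson v k n).1

/-- The normalised residual of `v k` modulo its successors up to `v (k + n)`. -/
def backwardResidual (v : ℕ → E) (k n : ℕ) : E := (levinson v k n).2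

/-- The correlation of `v k` and `v (k + n + 1)` modulo the vectors between them. -/
def partialCorrelation (v : ℕ → E) (k n : ℕ) : ℂ :=
  inner ℂ (backwardResidual v k n) (forwardResidual v (k + 1) n)

variable (v : ℕ → E)

@[simp] lemma forwardResidual_zero (k : ℕ) : forwardResidual v k 0 = v k := by
  simp [forwardResidual, levinson]

@[simp] lemma backwardResidual_zero (k : ℕ) : backwardResidual v k 0 = v k := by
  simp [backwardResidual, levinson]

lemma forwardResidual_succ (k n : ℕ) :
    forwardResidual v k (n + 1) = (defect (partialCorrelation v k n) : ℂ)⁻¹ •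
      (forwardResidual v (k + 1) n - partialCorrelation v k n • backwardResidual v k n) := rfl

lemma backwardResidual_succ (k n : ℕ) :
    backwardResidual v k (n + 1) = (defect (partialCorrelation v k n) : ℂ)⁻¹ •
      (backwardResidual v k n - conj (partialCorrelation v k n) • forwardResidual v (k + 1) n) :=
  rfl

lemma norm_sub_inner_smul_sq {φ ψ : E} (hφ : ‖φ‖ = 1) (hψ : ‖ψ‖ = 1) :
    ‖φ - (inner ℂ ψ φ : ℂ) • ψ‖ ^ 2 = 1 - ‖(inner ℂ ψ φ : ℂ)‖ ^ 2 := by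
  rw [@norm_sub_sq ℂ, norm_smul, inner_smul_right, hφ, hψ, inner_mul_symm_re_eq_norm,
    norm_mul, norm_inner_symm φ ψ]
  ring

lemma defect_sq {c : ℂ} (hc : ‖c‖ < 1) : defect c ^ 2 = 1 - ‖c‖ ^ 2 :=
  Real.sq_sqrt (by nlinarith [norm_nonneg c])

lemma defect_pos {c : ℂ} (hc : ‖c‖ < 1) : 0 < defect c :=
  Real.sqrt_pos.2 (by nlinarith [norm_nonneg c])

lemma defect_mul_self {c : ℂ} (hc : ‖c‖ < 1) : (defect c : ℂ) * defect c + conj c * c = 1 := by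
  have h := defect_sq hc
  rw [mul_comm (conj c), Complex.mul_conj, Complex.normSq_eq_norm_sq, ← sq]
  norm_cast
  linarith

/-- The properties of the residuals that drive the Levinson recursion. -/
structure ResidualSpec (k n : ℕ) : Prop where
  norm_forward : ‖forwardResidual v k n‖ = 1
  norm_backward : ‖backwardResidual v k n‖ = 1
  forward_mem : forwardResidual v k n ∈ Submodule.span ℂ (v '' Set.Icc k (k + n))
  backward_mem : backwardResidual v k n ∈ Submodule.span ℂ (v '' Set.Icc k (k + n))
  inner_forward : ∀ i, k ≤ i → i < k + n → inner ℂ (v i) (forwardResidual v k n) = (0 : ℂ)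
  inner_backward : ∀ i, k < i → i ≤ k + n → inner ℂ (v i) (backwardResidual v k n) = (0 : ℂ)
  leading_forward : ∃ a : ℂ,
    v (k + n) - a • forwardResidual v k n ∈ Submodule.span ℂ (v '' Set.Ico k (k + n))
  leading_backward : ∃ a : ℂ,
    v k - a • backwardResidual v k n ∈ Submodule.span ℂ (v '' Set.Ioc k (k + n))

variable {v}

/-- The residual left by projecting one unit vector off another has squared length `1 - |c|²`. Were
it zero, the leading term of the forward residual would express `v (k + n + 1)` through its
predecessors, against linear independence. -/
lemma norm_partialCorrelation_lt (hli : LinearIndependent ℂ v) {k n : ℕ}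
    (h0 : ResidualSpec v k n) (h1 : ResidualSpec v (k + 1) n) :
    ‖partialCorrelation v k n‖ < 1 := by
  obtain ⟨a, hmem⟩ := h1.leading_forward
  have hne : forwardResidual v (k + 1) n -
      partialCorrelation v k n • backwardResidual v k n ≠ 0 := by
    intro h
    have e1 : Submodule.span ℂ (v '' Set.Ico (k + 1) (k + 1 + n)) ≤
        Submodule.span ℂ (v '' Set.Ico k (k + 1 + n)) :=
      Submodule.span_mono (Set.image_mono (Set.Ico_subset_Ico (by omega) le_rfl))
    have e2 : Submodule.span ℂ (v '' Set.Icc k (k + n)) ≤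
        Submodule.span ℂ (v '' Set.Ico k (k + 1 + n)) :=
      Submodule.span_mono (Set.image_mono (fun i hi => ⟨hi.1, by have := hi.2; omega⟩))
    have e3 : v (k + 1 + n) ∈ Submodule.span ℂ (v '' Set.Ico k (k + 1 + n)) := by
      have := Submodule.add_mem _ (e1 hmem) (Submodule.smul_mem _ a
        (Submodule.smul_mem _ (partialCorrelation v k n) (e2 h0.backward_mem)))
      rw [← sub_eq_zero.1 h] at this
      simpa using this
    have := hli.notMem_span_image (s := Set.Ico k (k + 1 + n)) (x := k + 1 + n) (by simp)
    exact this e3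
  have h := norm_sub_inner_smul_sq h1.norm_forward h0.norm_backward
  have hpos : 0 < ‖forwardResidual v (k + 1) n -
      partialCorrelation v k n • backwardResidual v k n‖ ^ 2 := by positivity
  unfold partialCorrelation at hpos ⊢
  rw [h] at hpos
  nlinarith [norm_nonneg (inner ℂ (backwardResidual v k n) (forwardResidual v (k + 1) n) : ℂ)]

lemma inner_eq_zero_of_mem_span {t : Set ℕ} {x y : E} (h : ∀ i ∈ t, inner ℂ (v i) y = (0 : ℂ))
    (hx : x ∈ Submodule.span ℂ (v '' t)) : inner ℂ x y = (0 : ℂ) := by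
  have : Submodule.span ℂ (v '' t) ≤ (Submodule.span ℂ {y})ᗮ := by
    rw [Submodule.span_le]
    rintro _ ⟨i, hi, rfl⟩
    exact (Submodule.mem_orthogonal_singleton_iff_inner_left).2 (h i hi)
  exact (Submodule.mem_orthogonal_singleton_iff_inner_left).1 (this hx)

/-- Induction on the length. Each new residual is the part of one old residual orthogonal to the
other. It is orthogonal to the interior vectors because both old residuals are, and to the remaining
endpoint because that endpoint is, modulo interior vectors, a multiple of the old residual that was
projected away. -/
lemma residualSpec (hv : ∀ k, ‖v k‖ = 1) (hli : LinearIndependent ℂ v) (n : ℕ) :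
    ∀ k, ResidualSpec v k n := by
  induction n with
  | zero =>
    intro k
    refine ⟨by simp [hv], by simp [hv], ?_, ?_, by intros; omega, by intros; omega,
      ⟨1, by simp⟩, ⟨1, by simp⟩⟩ <;>
    exact Submodule.subset_span ⟨k, by simp, by simp⟩
  | succ n ih =>
    intro k
    have h0 := ih k
    have h1 := ih (k + 1)
    have hlt := norm_partialCorrelation_lt hli h0 h1
    have hd := defect_pos hlt
    have hdC : (defect (partialCorrelation v k n) : ℂ) ≠ 0 := by exact_mod_cast hd.ne'
    have m1 : Submodule.span ℂ (v '' Set.Icc k (k + n)) ≤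
        Submodule.span ℂ (v '' Set.Icc k (k + (n + 1))) :=
      Submodule.span_mono (Set.image_mono (Set.Icc_subset_Icc le_rfl (by omega)))
    have m2 : Submodule.span ℂ (v '' Set.Icc (k + 1) (k + 1 + n)) ≤
        Submodule.span ℂ (v '' Set.Icc k (k + (n + 1))) :=
      Submodule.span_mono (Set.image_mono (Set.Icc_subset_Icc (by omega) (by omega)))
    have hself0 : (inner ℂ (backwardResidual v k n) (backwardResidual v k n) : ℂ) = 1 := by
      rw [inner_self_eq_norm_sq_to_K, h0.norm_backward]; simp
    have hself1 :
        (inner ℂ (forwardResidual v (k + 1) n) (forwardResidual v (k + 1) n) : ℂ) = 1 := by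
      rw [inner_self_eq_norm_sq_to_K, h1.norm_forward]; simp
    have norm_eq : ∀ x : E, ‖x‖ ^ 2 = 1 - ‖partialCorrelation v k n‖ ^ 2 →
        ‖(defect (partialCorrelation v k n) : ℂ)⁻¹ • x‖ = 1 := by
      intro x hx
      rw [← defect_sq hlt] at hx
      have hx' : ‖x‖ = defect (partialCorrelation v k n) :=
        (pow_left_inj₀ (norm_nonneg _) hd.le two_ne_zero).1 hx
      rw [norm_smul, norm_inv, Complex.norm_real, hx', Real.norm_of_nonneg hd.le]
      exact inv_mul_cancel₀ hd.ne'
    obtain ⟨a, ha⟩ := h1.leading_forward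
    obtain ⟨b, hb⟩ := h0.leading_backward
    rw [show k + 1 + n = k + (n + 1) by omega] at ha
    refine ⟨?_, ?_, ?_, ?_, ?_, ?_, ?_, ?_⟩
    · rw [forwardResidual_succ]
      exact norm_eq _ (norm_sub_inner_smul_sq h1.norm_forward h0.norm_backward)
    · rw [backwardResidual_succ]
      refine norm_eq _ ?_
      have := norm_sub_inner_smul_sq h0.norm_backward h1.norm_forward
      rw [norm_inner_symm] at this
      rw [partialCorrelation, inner_conj_symm]
      exact this
    · rw [forwardResidual_succ]
      exact Submodule.smul_mem _ _ (Submodule.sub_mem _ (m2 h1.forward_mem)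
        (Submodule.smul_mem _ _ (m1 h0.backward_mem)))
    · rw [backwardResidual_succ]
      exact Submodule.smul_mem _ _ (Submodule.sub_mem _ (m1 h0.backward_mem)
        (Submodule.smul_mem _ _ (m2 h1.forward_mem)))
    · have perp : ∀ i, k < i → i ≤ k + n →
          inner ℂ (v i) (forwardResidual v k (n + 1)) = (0 : ℂ) := by
        intro i hi hin
        rw [forwardResidual_succ, inner_smul_right, inner_sub_right, inner_smul_right,
          h0.inner_backward i hi hin, h1.inner_forward i hi (by omega)]
        simp
      have perpB : inner ℂ (backwardResidual v k n) (forwardResidual v k (n + 1)) = (0 : ℂ) := by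
        rw [forwardResidual_succ, inner_smul_right, inner_sub_right, inner_smul_right, hself0]
        simp [partialCorrelation]
      intro i hi hin
      rcases hi.eq_or_lt with rfl | hi
      · have := inner_eq_zero_of_mem_span (t := Set.Ioc k (k + n))
          (fun i hi => perp i hi.1 hi.2) hb
        rwa [inner_sub_left, inner_smul_left, perpB, mul_zero, sub_zero] at this
      · exact perp i hi (by omega)
    · have perp : ∀ i, k < i → i ≤ k + n →
          inner ℂ (v i) (backwardResidual v k (n + 1)) = (0 : ℂ) := by
        intro i hi hin
        rw [backwardResidual_succ, inner_smul_right, inner_sub_right, inner_smul_right,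
          h0.inner_backward i hi hin, h1.inner_forward i hi (by omega)]
        simp
      have perpF : inner ℂ (forwardResidual v (k + 1) n) (backwardResidual v k (n + 1)) =
          (0 : ℂ) := by
        rw [backwardResidual_succ, inner_smul_right, inner_sub_right, inner_smul_right, hself1]
        simp [partialCorrelation]
      intro i hi hin
      rcases hin.eq_or_lt with rfl | hin
      · have := inner_eq_zero_of_mem_span (t := Set.Ico (k + 1) (k + (n + 1)))
          (fun i hi => perp i hi.1 (by have := hi.2; omega)) ha
        rwa [inner_sub_left, inner_smul_left, perpF, mul_zero, sub_zero] at this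
      · exact perp i hi (by omega)
    · refine ⟨a * defect (partialCorrelation v k n), ?_⟩
      rw [forwardResidual_succ, mul_smul, smul_inv_smul₀ hdC, smul_sub, ← sub_add]
      refine Submodule.add_mem _ ?_ (Submodule.smul_mem _ _ (Submodule.smul_mem _ _ ?_))
      · exact Submodule.span_mono (Set.image_mono (Set.Ico_subset_Ico (by omega) le_rfl)) ha
      · exact Submodule.span_mono (Set.image_mono (Set.Icc_subset_Ico_right (by omega)))
          h0.backward_mem
    · refine ⟨b * defect (partialCorrelation v k n), ?_⟩
      rw [backwardResidual_succ, mul_smul, smul_inv_smul₀ hdC, smul_sub, ← sub_add]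
      refine Submodule.add_mem _ ?_ (Submodule.smul_mem _ _ (Submodule.smul_mem _ _ ?_))
      · exact Submodule.span_mono (Set.image_mono (Set.Ioc_subset_Ioc le_rfl (by omega))) hb
      · exact Submodule.span_mono (Set.image_mono (Set.Icc_subset_Ioc (by omega) (by omega)))
          h1.forward_mem

lemma norm_partialCorrelation_lt_one (hv : ∀ k, ‖v k‖ = 1) (hli : LinearIndependent ℂ v)
    (k n : ℕ) : ‖partialCorrelation v k n‖ < 1 :=
  norm_partialCorrelation_lt hli (residualSpec hv hli n k) (residualSpec hv hli n (k + 1))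

/-- One rotation step: the forward residual of the shorter range. -/
lemma forwardResidual_eq_add (hv : ∀ k, ‖v k‖ = 1) (hli : LinearIndependent ℂ v) (k n : ℕ) :
    forwardResidual v (k + 1) n = partialCorrelation v k n • backwardResidual v k n +
      (defect (partialCorrelation v k n) : ℂ) • forwardResidual v k (n + 1) := by
  have hd := defect_pos (norm_partialCorrelation_lt_one hv hli k n)
  rw [forwardResidual_succ, smul_inv_smul₀ (by exact_mod_cast hd.ne')]
  abel

/-- One rotation step: the backward residual of the longer range. -/
lemma backwardResidual_succ_eq_sub (hv : ∀ k, ‖v k‖ = 1) (hli : LinearIndependent ℂ v)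
    (k n : ℕ) :
    backwardResidual v k (n + 1) =
      (defect (partialCorrelation v k n) : ℂ) • backwardResidual v k n -
        conj (partialCorrelation v k n) • forwardResidual v k (n + 1) := by
  have hlt := norm_partialCorrelation_lt_one hv hli k n
  have hd : (defect (partialCorrelation v k n) : ℂ) ≠ 0 := by exact_mod_cast (defect_pos hlt).ne'
  have h := defect_mul_self hlt
  set c := partialCorrelation v k n
  have h1 : forwardResidual v (k + 1) n = c • backwardResidual v k n +
      (defect c : ℂ) • forwardResidual v k (n + 1) := forwardResidual_eq_add hv hli k n
  rw [backwardResidual_succ, inv_smul_eq_iff₀ hd, h1]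
  change _ - conj c • _ = _
  -- Splitting the coefficient `1` of the backward residual as `d² + |c|²` lets the `|c|²` part
  -- cancel.
  nth_rw 1 [← one_smul ℂ (backwardResidual v k n), ← h]
  module

/-- The initial vector in terms of its residual and of later vectors. -/
lemma sub_prod_smul_backwardResidual_mem (hv : ∀ k, ‖v k‖ = 1) (hli : LinearIndependent ℂ v)
    (k n : ℕ) :
    v k - (∏ m ∈ Finset.range n, (defect (partialCorrelation v k m) : ℂ)) • backwardResidual v k n
      ∈ Submodule.span ℂ (v '' Set.Ioc k (k + n)) := by
  induction n with
  | zero => simp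
  | succ n ih =>
    have hd : (defect (partialCorrelation v k n) : ℂ) ≠ 0 := by
      exact_mod_cast (defect_pos (norm_partialCorrelation_lt_one hv hli k n)).ne'
    rw [backwardResidual_succ, Finset.prod_range_succ, mul_smul, smul_inv_smul₀ hd, smul_sub,
      ← sub_add]
    refine Submodule.add_mem _ ?_ (Submodule.smul_mem _ _ (Submodule.smul_mem _ _ ?_))
    · exact Submodule.span_mono (Set.image_mono (Set.Ioc_subset_Ioc le_rfl (by omega))) ih
    · exact Submodule.span_mono (Set.image_mono (Set.Icc_subset_Ioc (by omega) (by omega)))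
        (residualSpec hv hli n (k + 1)).forward_mem

/-- The forward residual is orthogonal to the vectors strictly between, so only the component of `v
k` along its own backward residual contributes. -/
lemma inner_forwardResidual (hv : ∀ k, ‖v k‖ = 1) (hli : LinearIndependent ℂ v) (k n : ℕ) :
    inner ℂ (v k) (forwardResidual v (k + 1) n) =
      (∏ m ∈ Finset.range n, (defect (partialCorrelation v k m) : ℂ)) *
        partialCorrelation v k n := by
  have h := inner_eq_zero_of_mem_span (t := Set.Ioc k (k + n))
    (y := forwardResidual v (k + 1) n)
    (fun i hi => (residualSpec hv hli n (k + 1)).inner_forward i hi.1 (by have := hi.2; omega))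
    (sub_prod_smul_backwardResidual_mem hv hli k n)
  rw [inner_sub_left, inner_smul_left, sub_eq_zero] at h
  rw [h, partialCorrelation, map_prod]
  simp

/-- The last vector in terms of its residual and of the backward residuals. -/
lemma eq_forwardResidual_add_sum (hv : ∀ k, ‖v k‖ = 1) (hli : LinearIndependent ℂ v) (j l : ℕ)
    (hl : l ≤ j) :
    v j = (∏ m ∈ Finset.range l, (defect (partialCorrelation v (j - 1 - m) m) : ℂ)) •
        forwardResidual v (j - l) l +
      ∑ i ∈ Finset.range l, (partialCorrelation v (j - 1 - i) i *
        ∏ m ∈ Finset.range i, (defect (partialCorrelation v (j - 1 - m) m) : ℂ)) •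
          backwardResidual v (j - 1 - i) i := by
  induction l with
  | zero => simp
  | succ l ih =>
    have h := forwardResidual_eq_add hv hli (j - 1 - l) l
    rw [show j - 1 - l + 1 = j - l by omega] at h
    rw [ih (by omega), h, Finset.sum_range_succ, Finset.prod_range_succ,
      show j - (l + 1) = j - 1 - l by omega]
    module

/-! ### Rotations as changes of coordinates between residuals -/

/-- The vectors interpolating between the forward residuals over `k, …` (`m = 0`) and those over
`k + 1, …`. -/
def mixedResidual (v : ℕ → E) (k m i : ℕ) : E :=
  if i < m then forwardResidual v (k + 1) i
  else if i = m then backwardResidual v k m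
  else forwardResidual v k i

/-- The families at stages `m` and `m + 1` differ only in the coordinates `m` and `m + 1`. There the
two Levinson identities say that the pair at stage `m + 1` arises from the pair at stage `m` through
exactly the matrix of the elementary rotation. -/
lemma sum_elemRotation (hv : ∀ k, ‖v k‖ = 1) (hli : LinearIndependent ℂ v) (k m N : ℕ)
    (hm : m + 1 < N) (x : ℕ → ℂ) :
    ∑ i ∈ Finset.range N, elemRotation m (partialCorrelation v k m) x i • mixedResidual v k m i =
      ∑ i ∈ Finset.range N, x i • mixedResidual v k (m + 1) i := by
  have hsub : {m, m + 1} ⊆ Finset.range N := by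
    intro i hi
    simp only [Finset.mem_insert, Finset.mem_singleton] at hi
    exact Finset.mem_range.2 (by omega)
  rw [← Finset.sum_sdiff hsub, ← Finset.sum_sdiff (f := fun i => x i • _) hsub]
  congr 1
  · refine Finset.sum_congr rfl fun i hi => ?_
    simp only [Finset.mem_sdiff, Finset.mem_insert, Finset.mem_singleton, not_or] at hi
    obtain ⟨-, h1, h2⟩ := hi
    have h3 : i < m ∨ m + 1 < i := by omega
    rcases h3 with h3 | h3
    · simp [elemRotation, mixedResidual, h1, h2, h3, show i < m + 1 by omega]
    · simp [elemRotation, mixedResidual, h1, h2, show ¬ i < m by omega, show ¬ i < m + 1 by omega]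
  · rw [Finset.sum_pair (by omega), Finset.sum_pair (by omega)]
    have h1 := forwardResidual_eq_add hv hli k m
    have h2 := backwardResidual_succ_eq_sub hv hli k m
    simp only [elemRotation, mixedResidual, lt_irrefl, if_true, if_false,
      show ¬ m + 1 = m by omega, show ¬ m + 1 < m by omega, show m < m + 1 by omega, h1, h2]
    module

/-- Composition of the elementary exchanges. The chain ends at the forward residuals over `k`
because the two residuals of length zero coincide. -/
lemma sum_rotationChain (hv : ∀ k, ‖v k‖ = 1) (hli : LinearIndependent ℂ v) (γ : ℕ → ℕ → ℂ)
    (k N m : ℕ) (hm : m < N) (hγ : ∀ i < m, γ k (k + i + 1) = partialCorrelation v k i)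
    (x : ℕ → ℂ) :
    ∑ i ∈ Finset.range N, rotationChain γ k m x i • forwardResidual v k i =
      ∑ i ∈ Finset.range N, x i • mixedResidual v k m i := by
  induction m generalizing x with
  | zero =>
    refine Finset.sum_congr rfl fun i _ => ?_
    rcases Nat.eq_zero_or_pos i with rfl | hi
    · simp [mixedResidual, rotationChain]
    · simp [mixedResidual, hi.ne', rotationChain]
  | succ m ih =>
    rw [rotationChain, ih (by omega) (fun i hi => hγ i (by omega)), hγ m (by omega),
      sum_elemRotation hv hli k m N hm]

lemma rotationChain_of_lt (γ : ℕ → ℕ → ℂ) (k m : ℕ) (x : ℕ → ℂ) (i : ℕ) (hi : m < i) :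
    rotationChain γ k m x i = x i := by
  induction m generalizing x with
  | zero => rfl
  | succ m ih =>
    rw [rotationChain, ih _ (by omega)]
    simp [elemRotation, show i ≠ m by omega, show i ≠ m + 1 by omega]

lemma generalRotation_of_lt (γ : ℕ → ℕ → ℂ) (k n : ℕ) (x : ℕ → ℂ) (i : ℕ) (hi : n < i) :
    generalRotation γ k n x i = x i := by
  induction n generalizing k with
  | zero => rfl
  | succ n ih => rw [generalRotation, rotationChain_of_lt _ _ _ _ _ hi, ih _ (by omega)]

/-- `generalRotation` changes from the backward to the forward residuals. -/
lemma sum_generalRotation (hv : ∀ k, ‖v k‖ = 1) (hli : LinearIndependent ℂ v) (γ : ℕ → ℕ → ℂ)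
    (n k : ℕ) (hγ : ∀ a b, k ≤ a → a + b < k + n → γ a (a + b + 1) = partialCorrelation v a b)
    (x : ℕ → ℂ) :
    ∑ i ∈ Finset.range (n + 1), generalRotation γ k n x i • forwardResidual v k i =
      ∑ i ∈ Finset.range (n + 1), x i • backwardResidual v (k + n - i) i := by
  induction n generalizing k with
  | zero => simp [generalRotation]
  | succ n ih =>
    rw [generalRotation, sum_rotationChain hv hli γ k _ _ (by omega)
      (fun i hi => hγ k i le_rfl (by omega)), Finset.sum_range_succ,
      Finset.sum_range_succ _ (n + 1)]
    congr 1
    · have := ih (k + 1) (fun a b ha hb => hγ a b (by omega) (by omega))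
      rw [show k + 1 + n = k + (n + 1) by omega] at this
      rw [← this]
      refine Finset.sum_congr rfl fun i hi => ?_
      rw [mixedResidual, if_pos (Finset.mem_range.1 hi)]
    · simp [mixedResidual, generalRotation_of_lt]

/-! ### Identification of the Schur parameters and the defect product -/

/-- The parametrisation of the Gram kernel of unit vectors by partial correlations. -/
lemma inner_eq_schurCorner_add (hv : ∀ k, ‖v k‖ = 1) (hli : LinearIndependent ℂ v)
    (γ : ℕ → ℕ → ℂ) (k l : ℕ)
    (hγ : ∀ a b, b < l → γ a (a + b + 1) = partialCorrelation v a b) :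
    inner ℂ (v k) (v (k + l + 1)) = schurCorner γ k (k + l + 1) +
      (∏ m ∈ Finset.Ioo k (k + l + 1), (defect (γ k m) : ℂ)) *
        (∏ m ∈ Finset.Ioo k (k + l + 1), (defect (γ m (k + l + 1)) : ℂ)) *
          partialCorrelation v k l := by
  have hrow : ∀ n ≤ l, ∏ m ∈ Finset.Ioo k (k + n + 1), (defect (γ k m) : ℂ) =
      ∏ m ∈ Finset.range n, (defect (partialCorrelation v k m) : ℂ) := by
    intro n hn
    rw [show Finset.Ioo k (k + n + 1) = Finset.Ico (k + 1) (k + n + 1) by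
      ext; simp, Finset.prod_Ico_eq_prod_range,
      show k + n + 1 - (k + 1) = n by omega]
    refine Finset.prod_congr rfl fun m hm => ?_
    rw [show k + 1 + m = k + m + 1 by omega, hγ k m (by have := Finset.mem_range.1 hm; omega)]
  set j := k + l + 1 with hj
  have hcol : ∀ n ≤ l, ∏ m ∈ Finset.Ioo (j - 1 - n) j, (defect (γ m j) : ℂ) =
      ∏ m ∈ Finset.range n, (defect (partialCorrelation v (j - 1 - m) m) : ℂ) := by
    intro n hn
    rw [show Finset.Ioo (j - 1 - n) j = Finset.Ico (j - n) j by
      ext; simp; omega, Finset.prod_Ico_eq_prod_range, ← Finset.prod_range_reflect,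
      show j - (j - n) = n by omega]
    refine Finset.prod_congr rfl fun m hm => ?_
    have hm := Finset.mem_range.1 hm
    rw [show j - n + (n - 1 - m) = j - 1 - m by omega]
    have := hγ (j - 1 - m) m (by omega)
    rw [show j - 1 - m + m + 1 = j by omega] at this
    rw [this]
  -- The expansion of `v j` runs over backward residuals, whose coefficients are the column `C`. The
  -- rotation turns it into one over the forward residuals from `k + 1`, whose products with `v k`
  -- are the row `R`.
  have hsum : ∑ i ∈ Finset.range l, (partialCorrelation v (j - 1 - i) i *
        ∏ m ∈ Finset.range i, (defect (partialCorrelation v (j - 1 - m) m) : ℂ)) •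
          backwardResidual v (j - 1 - i) i =
      ∑ i ∈ Finset.range l, generalRotation γ (k + 1) (l - 1) (schurCol γ k j) i •
        forwardResidual v (k + 1) i := by
    -- For `l = 0` there is no corner term, and `l - 1` is a truncated subtraction.
    rcases Nat.eq_zero_or_pos l with rfl | hl
    · simp
    obtain ⟨n, rfl⟩ : ∃ n, l = n + 1 := ⟨l - 1, by omega⟩
    rw [show n + 1 - 1 = n by omega, sum_generalRotation hv hli γ n (k + 1)
      (fun a b ha hb => hγ a b (by omega))]
    refine Finset.sum_congr rfl fun i hi => ?_
    have hi := Finset.mem_range.1 hi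
    rw [schurCol, if_pos (by omega), hcol i (by omega), show k + 1 + n - i = j - 1 - i by omega]
    have := hγ (j - 1 - i) i (by omega)
    rw [show j - 1 - i + i + 1 = j by omega] at this
    rw [this]
  have hexp := eq_forwardResidual_add_sum hv hli j l (by omega)
  rw [hsum, show j - l = k + 1 by omega] at hexp
  rw [hexp, inner_add_right, inner_smul_right, inner_forwardResidual hv hli, inner_sum,
    hrow l le_rfl]
  have hc := hcol l le_rfl
  rw [show j - 1 - l = k by omega] at hc
  rw [hc, schurCorner, show j - 1 - k = l by omega, show j - k - 2 = l - 1 by omega, add_comm]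
  congr 1
  · refine Finset.sum_congr rfl fun i hi => ?_
    have hi := Finset.mem_range.1 hi
    rw [inner_smul_right, inner_forwardResidual hv hli, schurRow,
      show k + 1 + i = k + i + 1 by omega, hrow i hi.le, hγ k i hi]
    ring
  · ring

/-- The Schur parameters of a nondegenerate kernel are the partial correlations of the
normalised vectors it is the Gram kernel of. -/
theorem schurParam_eq_partialCorrelation (hv : ∀ k, ‖v k‖ = 1) (hli : LinearIndependent ℂ v)
    (K : ℕ → ℕ → ℂ)
    (hK : ∀ k j, K k j / (Real.sqrt (K k k).re * Real.sqrt (K j j).re : ℝ) = inner ℂ (v k) (v j))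
    (k n : ℕ) : schurParam K k (k + n + 1) = partialCorrelation v k n := by
  have main : ∀ l k n, n < l → schurTable K l k (k + n + 1) = partialCorrelation v k n := by
    intro l
    induction l with
    | zero => intro k n hn; omega
    | succ l ih =>
      intro k n hn
      simp only [schurTable]
      rcases Nat.lt_succ_iff_lt_or_eq.1 hn with h | rfl
      · rw [if_neg (by omega), ih k n h]
      · rw [if_pos (by omega), schurSolve, hK, inner_eq_schurCorner_add hv hli _ k n
          (fun a b hb => ih a b hb), add_sub_cancel_left, mul_div_cancel_left₀]
        -- All defects are positive, so the division in `schurSolve` is never by zero.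
        refine mul_ne_zero (Finset.prod_ne_zero_iff.2 ?_) (Finset.prod_ne_zero_iff.2 ?_)
        · intro m hm
          have hm := Finset.mem_Ioo.1 hm
          have := ih k (m - k - 1) (by omega)
          rw [show k + (m - k - 1) + 1 = m by omega] at this
          rw [this]
          exact_mod_cast (defect_pos (norm_partialCorrelation_lt_one hv hli _ _)).ne'
        · intro m hm
          have hm := Finset.mem_Ioo.1 hm
          have := ih m (k + n - m) (by omega)
          rw [show m + (k + n - m) + 1 = k + n + 1 by omega] at this
          rw [this]
          exact_mod_cast (defect_pos (norm_partialCorrelation_lt_one hv hli _ _)).ne'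
  rw [schurParam, show k + n + 1 - k = n + 1 by omega]
  exact main _ _ _ (by omega)

/-- The defect product is the squared distance of the initial vector to the following ones:
it is attained. -/
theorem exists_norm_sub_sq_eq_prod (hv : ∀ k, ‖v k‖ = 1) (hli : LinearIndependent ℂ v) (n : ℕ) :
    ∃ x ∈ Submodule.span ℂ (v '' Set.Ioc 0 n), ‖v 0 - x‖ ^ 2 =
      ∏ m ∈ Finset.range n, (1 - ‖partialCorrelation v 0 m‖ ^ 2) := by
  have h := sub_prod_smul_backwardResidual_mem hv hli 0 n
  rw [zero_add] at h
  refine ⟨_, h, ?_⟩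
  rw [sub_sub_cancel, norm_smul, (residualSpec hv hli n 0).norm_backward, mul_one, norm_prod,
    ← Finset.prod_pow]
  refine Finset.prod_congr rfl fun m _ => ?_
  rw [Complex.norm_real, Real.norm_eq_abs, sq_abs,
    defect_sq (norm_partialCorrelation_lt_one hv hli 0 m)]

/-- The defect product is the squared distance of the initial vector to the following ones:
it is a lower bound. -/
theorem prod_le_norm_sub_sq (hv : ∀ k, ‖v k‖ = 1) (hli : LinearIndependent ℂ v) (n : ℕ)
    (x : E) (hx : x ∈ Submodule.span ℂ (v '' Set.Ioc 0 n)) :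
    ∏ m ∈ Finset.range n, (1 - ‖partialCorrelation v 0 m‖ ^ 2) ≤ ‖v 0 - x‖ ^ 2 := by
  have hspec := residualSpec hv hli n 0
  have h := sub_prod_smul_backwardResidual_mem hv hli 0 n
  rw [zero_add] at h
  -- Both `x` and the optimal approximant lie in the span of the later vectors, to which the
  -- backward residual is orthogonal. Pythagoras then compares the two distances.
  have horth := inner_eq_zero_of_mem_span (t := Set.Ioc 0 n) (y := backwardResidual v 0 n)
    (fun i hi => hspec.inner_backward i hi.1 (by simpa using hi.2)) (Submodule.sub_mem _ hx h)
  set D := ∏ m ∈ Finset.range n, (defect (partialCorrelation v 0 m) : ℂ)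
  have hD : ‖D‖ ^ 2 = ∏ m ∈ Finset.range n, (1 - ‖partialCorrelation v 0 m‖ ^ 2) := by
    rw [norm_prod, ← Finset.prod_pow]
    refine Finset.prod_congr rfl fun m _ => ?_
    rw [Complex.norm_real, Real.norm_eq_abs, sq_abs,
      defect_sq (norm_partialCorrelation_lt_one hv hli 0 m)]
  have hn : ‖v 0 - x‖ ^ 2 = ‖D‖ ^ 2 + ‖x - (v 0 - D • backwardResidual v 0 n)‖ ^ 2 := by
    have e : v 0 - x =
        D • backwardResidual v 0 n - (x - (v 0 - D • backwardResidual v 0 n)) := by abel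
    rw [e, @norm_sub_sq ℂ, inner_smul_left, ← inner_conj_symm, horth, norm_smul,
      hspec.norm_backward]
    simp
  rw [hn, hD]
  exact le_add_of_nonneg_right (sq_nonneg _)

end SchurParameters

/-! ### The shortlex ordering -/

section Shortlex

variable {d : ℕ} {α β δ : Fin d → ℕ}

lemma ShortlexLT.trans (h₁ : ShortlexLT α β) (h₂ : ShortlexLT β δ) : ShortlexLT α δ := by
  rcases h₁ with h₁ | ⟨h₁, h₁'⟩ <;> rcases h₂ with h₂ | ⟨h₂, h₂'⟩
  · exact Or.inl (h₁.trans h₂)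
  · exact Or.inl (h₁.trans_eq h₂)
  · exact Or.inl (h₁.trans_lt h₂)
  · exact Or.inr ⟨h₁.trans h₂, h₂'.trans h₁'⟩

lemma ShortlexLT.irrefl (α : Fin d → ℕ) : ¬ ShortlexLT α α := by
  rintro (h | ⟨-, h⟩)
  · exact lt_irrefl _ h
  · exact lt_irrefl _ h

lemma ShortlexLT.trichotomy (α β : Fin d → ℕ) : ShortlexLT α β ∨ α = β ∨ ShortlexLT β α := by
  rcases lt_trichotomy (∑ i, α i) (∑ i, β i) with h | h | h
  · exact Or.inl (Or.inl h)
  · rcases lt_trichotomy (toLex α) (toLex β) with h' | h' | h'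
    · exact Or.inr (Or.inr (Or.inr ⟨h.symm, h'⟩))
    · exact Or.inr (Or.inl (toLex.injective h'))
    · exact Or.inl (Or.inr ⟨h, h'⟩)
  · exact Or.inr (Or.inr (Or.inl h))

lemma finite_setOf_shortlexLT (α : Fin d → ℕ) : {β | ShortlexLT β α}.Finite := by
  refine (Set.finite_Iic (fun _ : Fin d => ∑ i, α i)).subset fun β hβ i => ?_
  have h : ∑ i, β i ≤ ∑ i, α i := by
    rcases hβ with h | ⟨h, -⟩
    · exact h.le
    · exact h.le
  exact (Finset.single_le_sum (f := β) (fun _ _ => Nat.zero_le _) (Finset.mem_univ i)).trans h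

lemma shortlexPos_lt (h : ShortlexLT α β) : shortlexPos α < shortlexPos β := by
  refine Set.ncard_lt_ncard ⟨fun δ hδ => ShortlexLT.trans hδ h, fun hsub => ?_⟩
    (finite_setOf_shortlexLT β)
  exact ShortlexLT.irrefl α (hsub h)

lemma shortlexPos_injective : Function.Injective (shortlexPos (d := d)) := by
  intro α β h
  rcases ShortlexLT.trichotomy α β with h' | h' | h'
  · exact absurd h (shortlexPos_lt h').ne
  · exact h'
  · exact absurd h (shortlexPos_lt h').ne'

/-- The positions of the predecessors are distinct and lie below that of `α`, and by definition
their number is exactly this position. -/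
lemma image_shortlexPos (α : Fin d → ℕ) :
    shortlexPos '' {β | ShortlexLT β α} = Set.Iio (shortlexPos α) := by
  refine Set.eq_of_subset_of_ncard_le ?_ ?_ (Set.finite_Iio _)
  · rintro _ ⟨β, hβ, rfl⟩
    exact shortlexPos_lt hβ
  · rw [Set.ncard_image_of_injective _ shortlexPos_injective]
    simp [shortlexPos]

/-- By `image_shortlexPos` the range is downward closed, and it is infinite because there are
infinitely many multi-indices. -/
lemma shortlexPos_surjective [NeZero d] : Function.Surjective (shortlexPos (d := d)) := by
  intro n
  have hinf : (Set.range (shortlexPos (d := d))).Infinite :=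
    Set.infinite_range_of_injective shortlexPos_injective
  obtain ⟨_, ⟨α, rfl⟩, hα⟩ := hinf.exists_gt n
  have : n ∈ shortlexPos '' {β | ShortlexLT β α} := by
    rw [image_shortlexPos]; exact hα
  obtain ⟨β, -, hβ⟩ := this
  exact ⟨β, hβ⟩

/-- The shortlex enumeration of the multi-indices. -/
def shortlexEquiv (d : ℕ) [NeZero d] : (Fin d → ℕ) ≃ ℕ :=
  Equiv.ofBijective shortlexPos ⟨shortlexPos_injective, shortlexPos_surjective⟩

lemma shortlexNth_eq (d : ℕ) [NeZero d] (n : ℕ) :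
    shortlexNth d n = (shortlexEquiv d).symm n := by
  rw [Equiv.eq_symm_apply]
  exact Function.invFun_eq (shortlexPos_surjective n)

lemma shortlexPos_zero : shortlexPos (0 : Fin d → ℕ) = 0 := by
  rw [shortlexPos, Set.ncard_eq_zero (finite_setOf_shortlexLT _)]
  ext β
  simp only [Set.mem_ofPred_eq, Set.mem_empty_iff_false, iff_false]
  rintro (h | ⟨h, h'⟩)
  · simp at h
  · have : β = 0 := by
      funext i
      simp only [Pi.zero_apply, Finset.sum_const_zero, Finset.sum_eq_zero_iff] at h
      exact h i (Finset.mem_univ i)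
    subst this
    exact lt_irrefl _ h'

lemma shortlexNth_zero (d : ℕ) [NeZero d] : shortlexNth d 0 = 0 := by
  rw [shortlexNth_eq, Equiv.symm_apply_eq]
  exact shortlexPos_zero.symm

end Shortlex

/-! ### The surface measure -/

section SurfaceMeasure

variable {d : ℕ}

instance isProbabilityMeasure_sigma [NeZero d] : IsProbabilityMeasure (sigma d) := by
  constructor
  have : Nontrivial (Cn d) := by
    refine ⟨0, EuclideanSpace.single 0 1, fun h => ?_⟩
    have := congrArg norm h
    simp at this
  rw [sigma, Measure.smul_apply, smul_eq_mul]
  exact ENNReal.inv_mul_cancel (by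
    rw [Ne, Measure.measure_univ_eq_zero]
    exact Measure.toSphere_ne_zero _) (measure_ne_top _ _)

/-- The action of a real-linear isometry on the sphere. -/
def sphereMap (L : Cn d ≃ₗᵢ[ℝ] Cn d) (ζ : USphere d) : USphere d :=
  ⟨L ζ, by simp⟩

@[simp] lemma coe_sphereMap (L : Cn d ≃ₗᵢ[ℝ] Cn d) (ζ : USphere d) :
    (sphereMap L ζ : Cn d) = L ζ := rfl

lemma continuous_sphereMap (L : Cn d ≃ₗᵢ[ℝ] Cn d) : Continuous (sphereMap L) :=
  (L.continuous.comp continuous_subtype_val).subtype_mk _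

-- `toSphere` measures a set by the volume of the cone over it. A linear isometry carries cones to
-- cones and preserves volume.
open scoped Pointwise in
lemma measurePreserving_sphereMap (L : Cn d ≃ₗᵢ[ℝ] Cn d) :
    MeasurePreserving (sphereMap L) (sigma d) (sigma d) := by
  refine ⟨(continuous_sphereMap L).measurable, ?_⟩
  rw [sigma, Measure.map_smul]
  congr 1
  ext s hs
  rw [Measure.map_apply (continuous_sphereMap L).measurable hs, Measure.toSphere_apply' _ hs,
    Measure.toSphere_apply' _ ((continuous_sphereMap L).measurable hs)]
  congr 1
  have hpre : Set.Ioo (0 : ℝ) 1 • ((↑) '' (sphereMap L ⁻¹' s) : Set (Cn d)) =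
      L ⁻¹' (Set.Ioo (0 : ℝ) 1 • ((↑) '' s : Set (Cn d))) := by
    ext z
    simp only [Set.mem_smul, Set.mem_preimage, Set.mem_image]
    constructor
    · rintro ⟨r, hr, _, ⟨ζ, hζ, rfl⟩, rfl⟩
      exact ⟨r, hr, _, ⟨_, hζ, rfl⟩, by simp⟩
    · rintro ⟨r, hr, _, ⟨ζ, hζ, rfl⟩, h⟩
      refine ⟨r, hr, _, ⟨sphereMap L.symm ζ, ?_, rfl⟩, ?_⟩
      · have : sphereMap L (sphereMap L.symm ζ) = ζ := by ext1; simp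
        simpa [this] using hζ
      · rw [coe_sphereMap, ← map_smul, h]; simp
  rw [hpre]
  exact (L.measurePreserving).measure_preimage_equiv (f := L.toMeasurableEquiv) _

-- The cone over the trace of a real subspace stays in that subspace, which has volume zero when
-- proper.
open scoped Pointwise in
lemma sigma_null_of_submodule (V : Submodule ℝ (Cn d)) (hV : V ≠ ⊤) :
    sigma d {ζ | (ζ : Cn d) ∈ V} = 0 := by
  have hm : MeasurableSet {ζ : USphere d | (ζ : Cn d) ∈ V} :=
    (V.closed_of_finiteDimensional.preimage continuous_subtype_val).measurableSet
  rw [sigma, Measure.smul_apply, Measure.toSphere_apply' _ hm, smul_eq_mul]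
  have : volume
      (Set.Ioo (0 : ℝ) 1 • ((↑) '' {ζ : USphere d | (ζ : Cn d) ∈ V} : Set (Cn d))) = 0 := by
    refine measure_mono_null ?_ (Measure.addHaar_submodule volume V hV)
    rintro _ ⟨r, -, _, ⟨ζ, hζ, rfl⟩, rfl⟩
    exact V.smul_mem r hζ
  rw [this]; simp

/-- The real hyperplane `Im ⟨z, ζ⟩ = 0` contains `ζ` but not `iζ`, so it is proper and its trace on
the sphere is null. -/
instance noAtoms_sigma : NullSingletonClass (sigma d) := by
  constructor
  intro ζ
  let φ : Cn d →ₗ[ℝ] ℝ :=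
    Complex.imLm.comp ((innerSL ℂ (ζ : Cn d)).restrictScalars ℝ).toLinearMap
  have hself : (inner ℂ (ζ : Cn d) (ζ : Cn d) : ℂ) = 1 := by
    rw [inner_self_eq_norm_sq_to_K]; simp
  refine measure_mono_null (Set.singleton_subset_iff.2 ?_)
    (sigma_null_of_submodule (LinearMap.ker φ) fun h => ?_)
  · change (inner ℂ (ζ : Cn d) (ζ : Cn d) : ℂ).im = 0
    rw [hself, Complex.one_im]
  · have h1 : Complex.I • (ζ : Cn d) ∈ LinearMap.ker φ := h ▸ Submodule.mem_top
    change (inner ℂ (ζ : Cn d) (Complex.I • (ζ : Cn d)) : ℂ).im = 0 at h1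
    rw [inner_smul_right, hself] at h1
    simp at h1

/-- The diagonal action of the torus. -/
def torusIsometry (c : Fin d → Circle) : Cn d ≃ₗᵢ[ℝ] Cn d :=
  LinearIsometryEquiv.piLpCongrRight 2 (fun i => rotation (c i))

@[simp] lemma torusIsometry_apply (c : Fin d → Circle) (z : Cn d) (i : Fin d) :
    torusIsometry c z i = c i * z i := rfl

lemma torusIsometry_const (c : Circle) (z : Cn d) :
    torusIsometry (fun _ => c) z = (c : ℂ) • z := by
  ext i; simp

/-! ### Monomials on the sphere -/

/-- The monomial `z ↦ z ^ α`. -/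
def monom (α : Fin d → ℕ) (z : Cn d) : ℂ := ∏ i, z i ^ α i

lemma continuous_monom (α : Fin d → ℕ) : Continuous (monom α) := by
  unfold monom; fun_prop

lemma monom_torus (α : Fin d → ℕ) (c : Fin d → Circle) (z : Cn d) :
    monom α (torusIsometry c z) = (∏ i, (c i : ℂ) ^ α i) * monom α z := by
  simp [monom, mul_pow, Finset.prod_mul_distrib]

lemma integral_sphereMap {F : Type*} [NormedAddCommGroup F] [NormedSpace ℝ F]
    (L : Cn d ≃ₗᵢ[ℝ] Cn d) (f : USphere d → F) :
    ∫ ζ, f (sphereMap L ζ) ∂(sigma d) = ∫ ζ, f ζ ∂(sigma d) := by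
  refine (measurePreserving_sphereMap L).integral_comp
    ((continuous_sphereMap L).isClosedEmbedding fun ζ ξ h => ?_).measurableEmbedding f
  exact Subtype.ext (L.injective (congrArg Subtype.val h))

/-- Rotating a coordinate `i` with `α i ≠ β i` by the angle `π / (α i - β i)` preserves `σ` and
multiplies the integrand by `-1`. -/
lemma integral_monom_mul_conj_monom {α β : Fin d → ℕ} (h : α ≠ β) :
    ∫ ζ : USphere d, monom α ζ * conj (monom β ζ) ∂(sigma d) = 0 := by
  obtain ⟨i, hi⟩ := Function.ne_iff.1 h
  have hne : ((α i : ℂ) - β i) ≠ 0 := sub_ne_zero.2 (by exact_mod_cast hi)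
  set lam : Circle := Circle.exp (Real.pi / ((α i : ℝ) - β i)) with hlam
  let c : Fin d → Circle := Function.update 1 i lam
  have hprod : ∀ δ : Fin d → ℕ, ∏ j, (c j : ℂ) ^ δ j = (lam : ℂ) ^ δ i := by
    intro δ
    rw [Finset.prod_eq_single i]
    · simp [c]
    · intro j _ hj
      simp [c, hj]
    · simp
  have hneg : (lam : ℂ) ^ α i = -(lam : ℂ) ^ β i := by
    rw [hlam, Circle.coe_exp, ← Complex.exp_nat_mul, ← Complex.exp_nat_mul, ← mul_neg_one,
      ← Complex.exp_pi_mul_I, ← Complex.exp_add]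
    congr 1
    push_cast
    field_simp
    ring
  have hone : (lam : ℂ) ^ β i * conj ((lam : ℂ) ^ β i) = 1 := by
    rw [Complex.mul_conj, Complex.normSq_eq_norm_sq, norm_pow, Circle.norm_coe]
    simp
  have key := integral_sphereMap (torusIsometry c)
    (fun ζ : USphere d => monom α ζ * conj (monom β ζ))
  simp only [coe_sphereMap, monom_torus, hprod, hneg] at key
  have : ∀ ζ : USphere d, -(lam : ℂ) ^ β i * monom α ζ *
      conj ((lam : ℂ) ^ β i * monom β ζ) = -(monom α ζ * conj (monom β ζ)) := by
    intro ζ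
    rw [map_mul]
    linear_combination (-(monom α (ζ : Cn d) * conj (monom β (ζ : Cn d)))) * hone
  simp only [this, integral_neg] at key
  exact self_eq_neg.1 key.symm

lemma ae_monom_ne_zero (α : Fin d → ℕ) : ∀ᵐ ζ : USphere d ∂(sigma d), monom α ζ ≠ 0 := by
  have : ∀ i : Fin d, ∀ᵐ ζ : USphere d ∂(sigma d), (ζ : Cn d) i ≠ 0 := by
    intro i
    let φ : Cn d →ₗ[ℝ] ℂ := ((EuclideanSpace.proj (𝕜 := ℂ) i).restrictScalars ℝ).toLinearMap
    have := sigma_null_of_submodule (LinearMap.ker φ) (fun h => ?_)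
    · rw [ae_iff]
      simpa [φ] using this
    · have h1 : EuclideanSpace.single i (1 : ℂ) ∈ LinearMap.ker φ := h ▸ Submodule.mem_top
      simp [φ] at h1
  filter_upwards [ae_all_iff.2 this] with ζ hζ
  exact Finset.prod_ne_zero_iff.2 fun i _ => pow_ne_zero _ (hζ i)

end SurfaceMeasure

/-! ### Holomorphic functions of several variables -/

section Holomorphic

variable {d : ℕ}

/-- Directional derivatives of holomorphic functions are holomorphic. -/
lemma differentiableAt_fderiv_apply {f : Cn d → ℂ} {z₀ : Cn d} {R : ℝ} (hR : 0 < R)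
    (hf : DifferentiableOn ℂ f (ball z₀ R)) (v : Cn d) :
    DifferentiableAt ℂ (fun z => fderiv ℂ f z v) z₀ := by
  have hcont : ContinuousAt f z₀ := hf.continuousOn.continuousAt (ball_mem_nhds _ hR)
  -- The centre `z` varies within `ρ`, the displacement along `v` is at most `2ρ`, and Cauchy's
  -- estimate for the derivative needs a further ball of radius `ρ`: hence `4ρ`.
  obtain ⟨ρ, hρ, hρR, hbd⟩ : ∃ ρ > 0, 4 * ρ ≤ R ∧ ∀ z ∈ ball z₀ (4 * ρ), ‖f z - f z₀‖ ≤ 1 := by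
    obtain ⟨δ, hδ, h⟩ := Metric.continuousAt_iff.1 hcont 1 one_pos
    refine ⟨min δ R / 4, by positivity, ?_, fun z hz => ?_⟩
    · linarith [min_le_right δ R]
    · rw [← dist_eq_norm]
      refine (h ?_).le
      have := mem_ball.1 hz
      linarith [min_le_left δ R]
  have hd : DifferentiableOn ℂ f (ball z₀ (4 * ρ)) := hf.mono (ball_subset_ball hρR)
  have hdAt : ∀ z ∈ ball z₀ (4 * ρ), DifferentiableAt ℂ f z :=
    fun z hz => (hd z hz).differentiableAt (isOpen_ball.mem_nhds hz)
  have hfd : ∀ z ∈ ball z₀ (3 * ρ), ‖fderiv ℂ f z‖ ≤ 2 / ρ := by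
    intro z hz
    have hsub : ball z ρ ⊆ ball z₀ (4 * ρ) :=
      ball_subset_ball' (by have := mem_ball.1 hz; linarith)
    refine Complex.norm_fderiv_le_div_of_mapsTo_ball (hd.mono hsub) (fun y hy => ?_) hρ
    rw [mem_closedBall, dist_eq_norm]
    have h1 := hbd y (hsub hy)
    have h2 := hbd z (hsub (mem_ball_self hρ))
    calc ‖f y - f z‖ = ‖(f y - f z₀) - (f z - f z₀)‖ := by congr 1; ring
      _ ≤ ‖f y - f z₀‖ + ‖f z - f z₀‖ := norm_sub_le _ _
      _ ≤ 2 := by linarith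
  obtain ⟨s, hs, hsv⟩ : ∃ s > 0, s * ‖v‖ ≤ ρ := by
    refine ⟨ρ / (‖v‖ + 1), by positivity, ?_⟩
    rw [div_mul_eq_mul_div, div_le_iff₀ (by positivity)]
    nlinarith [norm_nonneg v]
  have hmem : ∀ z ∈ ball z₀ ρ, ∀ t : ℂ, ‖t‖ ≤ 2 * s → z + t • v ∈ ball z₀ (3 * ρ) := by
    intro z hz t ht
    rw [mem_ball, dist_eq_norm] at hz ⊢
    calc ‖z + t • v - z₀‖ = ‖(z - z₀) + t • v‖ := by congr 1; abel
      _ ≤ ‖z - z₀‖ + ‖t‖ * ‖v‖ := (norm_add_le _ _).trans_eq (by rw [norm_smul])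
      _ < ρ + 2 * ρ := by nlinarith [norm_nonneg v]
      _ = 3 * ρ := by ring
  have h34 : ball z₀ (3 * ρ) ⊆ ball z₀ (4 * ρ) := ball_subset_ball (by linarith)
  have hcm : ∀ θ, ‖circleMap 0 s θ‖ ≤ 2 * s := by
    intro θ; rw [norm_circleMap_zero, abs_of_pos hs]; linarith
  -- Cauchy's formula for the derivative at `t = 0` of `f (z + t v)`. The resulting integral depends
  -- on `z` only through `f`, and can be differentiated in `z` under the integral sign thanks to the
  -- uniform bound `2 / ρ`.
  have hformula : (fun z => fderiv ℂ f z v) =ᶠ[𝓝 z₀] fun z =>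
      (2 * Real.pi * Complex.I : ℂ)⁻¹ • ∮ t in C(0, s), ((t - 0) ^ 2)⁻¹ • f (z + t • v) := by
    filter_upwards [ball_mem_nhds z₀ hρ] with z hz
    have hdiff : DifferentiableOn ℂ (fun t : ℂ => f (z + t • v)) (ball 0 (2 * s)) := by
      intro t ht
      have := hdAt _ (h34 (hmem z hz t (mem_ball_zero_iff.1 ht).le))
      exact (this.comp t (by fun_prop : DifferentiableAt ℂ (fun t : ℂ => z + t • v) t)
        ).differentiableWithinAt
    rw [Complex.two_pi_I_inv_smul_circleIntegral_sub_sq_inv_smul_of_differentiable isOpen_ball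
      (closedBall_subset_ball (by linarith)) hdiff (mem_ball_self hs)]
    have h0 : HasFDerivAt f (fderiv ℂ f z) (z + (0 : ℂ) • v) := by
      rw [zero_smul, add_zero]
      exact (hdAt z (h34 (by simpa using hmem z hz 0 (by simp [hs.le])))).hasFDerivAt
    have h1 : HasDerivAt (fun t : ℂ => z + t • v) v 0 := by
      simpa using ((hasDerivAt_id (0 : ℂ)).smul_const v).const_add z
    exact (h0.comp_hasDerivAt (0 : ℂ) h1).deriv.symm
  refine DifferentiableAt.congr_of_eventuallyEq ?_ hformula
  suffices h : DifferentiableAt ℂ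
      (fun z => ∮ t in C(0, s), ((t - 0) ^ 2)⁻¹ • f (z + t • v)) z₀ from
    h.const_smul (2 * Real.pi * Complex.I : ℂ)⁻¹
  simp only [circleIntegral]
  have hcont2 : ∀ z ∈ ball z₀ ρ, Continuous fun θ : ℝ =>
      deriv (circleMap 0 s) θ • ((circleMap 0 s θ - 0) ^ 2)⁻¹ • f (z + circleMap 0 s θ • v) := by
    intro z hz
    have hne : ∀ θ, (circleMap 0 s θ - 0) ^ 2 ≠ 0 := fun θ => by simp [hs.ne']
    have : Continuous fun θ : ℝ => f (z + circleMap 0 s θ • v) := by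
      refine continuous_iff_continuousAt.2 fun θ => ?_
      have h := (hdAt _ (h34 (hmem z hz _ (hcm θ)))).continuousAt
      exact ContinuousAt.comp (f := fun θ : ℝ => z + circleMap 0 s θ • v) h
        (by fun_prop)
    have hd' : Continuous fun θ : ℝ => deriv (circleMap 0 s) θ := by
      simp only [deriv_circleMap]; fun_prop
    exact hd'.smul ((Continuous.inv₀ (by fun_prop) hne).smul this)
  have hnorm : ∀ θ, ‖deriv (circleMap 0 s) θ‖ * ‖((circleMap 0 s θ - 0) ^ 2)⁻¹‖ = s⁻¹ := by
    intro θ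
    simp [abs_of_pos hs]
    field_simp
  refine (intervalIntegral.hasFDerivAt_integral_of_dominated_of_fderiv_le (𝕜 := ℂ)
    (μ := volume) (s := ball z₀ ρ) (bound := fun _ => s⁻¹ * (2 / ρ))
    (F' := fun z θ => deriv (circleMap 0 s) θ • ((circleMap 0 s θ - 0) ^ 2)⁻¹ •
      fderiv ℂ f (z + circleMap 0 s θ • v))
    (ball_mem_nhds _ hρ) ?_ ?_ ?_ ?_ ?_ ?_).differentiableAt
  · filter_upwards [ball_mem_nhds z₀ hρ] with z hz
    exact (hcont2 z hz).aestronglyMeasurable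
  · exact (hcont2 z₀ (mem_ball_self hρ)).intervalIntegrable _ _
  · have h1 : Measurable fun θ : ℝ => fderiv ℂ f (z₀ + circleMap 0 s θ • v) :=
      (measurable_fderiv ℂ f).comp
        (by fun_prop : Continuous fun θ : ℝ => z₀ + circleMap 0 s θ • v).measurable
    have h2 : Measurable fun θ : ℝ => deriv (circleMap 0 s) θ := measurable_deriv _
    have h3 : Measurable fun θ : ℝ => ((circleMap 0 s θ - 0) ^ 2)⁻¹ := by fun_prop
    exact (h2.smul (h3.smul h1)).aestronglyMeasurable
  · refine Eventually.of_forall fun θ _ z hz => ?_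
    rw [norm_smul, norm_smul, ← mul_assoc, hnorm]
    exact mul_le_mul_of_nonneg_left (hfd _ (hmem z hz _ (hcm θ))) (by positivity)
  · exact intervalIntegrable_const
  · refine Eventually.of_forall fun θ _ z hz => ?_
    have h := (hdAt _ (h34 (hmem z hz _ (hcm θ)))).hasFDerivAt
    have h' : HasFDerivAt (fun z => f (z + circleMap 0 s θ • v))
        (fderiv ℂ f (z + circleMap 0 s θ • v)) z := h.comp z ((hasFDerivAt_id z).add_const _)
    exact (h'.const_smul ((circleMap 0 s θ - 0) ^ 2)⁻¹).const_smul (deriv (circleMap 0 s) θ)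

lemma differentiableOn_fderiv_apply {f : Cn d → ℂ} {R : ℝ}
    (hf : DifferentiableOn ℂ f (ball 0 R)) (v : Cn d) :
    DifferentiableOn ℂ (fun z => fderiv ℂ f z v) (ball 0 R) := by
  intro z hz
  obtain ⟨ε, hε, hsub⟩ := Metric.isOpen_iff.1 isOpen_ball z hz
  exact (differentiableAt_fderiv_apply hε (hf.mono hsub) v).differentiableWithinAt

lemma differentiableOn_slice {f : Cn d → ℂ} {R r : ℝ} (hf : DifferentiableOn ℂ f (ball 0 R))
    {z : Cn d} (hz : r * ‖z‖ ≤ R) (hR : 0 < R) :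
    DifferentiableOn ℂ (fun t : ℂ => f (t • z)) (ball 0 r) := by
  refine hf.comp (by fun_prop) fun t ht => ?_
  rw [mem_ball_zero_iff] at ht ⊢
  rw [norm_smul]
  rcases (norm_nonneg z).eq_or_lt with h | h
  · rwa [← h, mul_zero]
  · exact (mul_lt_mul_of_pos_right ht h).trans_le hz

/-- The homogeneous polynomials of degree `n`. -/
def homogeneousSpan (d n : ℕ) : Submodule ℂ (Cn d → ℂ) :=
  Submodule.span ℂ (monom '' {α | ∑ i, α i = n})

lemma coord_mul_mem_homogeneousSpan {n : ℕ} {p : Cn d → ℂ} (hp : p ∈ homogeneousSpan d n)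
    (i : Fin d) : (fun z : Cn d => z i * p z) ∈ homogeneousSpan d (n + 1) := by
  induction hp using Submodule.span_induction with
  | mem p hp =>
    obtain ⟨α, hα, rfl⟩ := hp
    refine Submodule.subset_span ⟨α + Pi.single i 1, ?_, ?_⟩
    · have hα : ∑ i, α i = n := hα
      simp [Finset.sum_add_distrib, hα]
    · funext z
      simp only [monom, Pi.add_apply, pow_add, Finset.prod_mul_distrib]
      rw [mul_comm]
      congr 1
      rw [Finset.prod_eq_single i] <;> simp +contextual
  | zero => simp only [Pi.zero_apply, mul_zero]; exact Submodule.zero_mem _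
  | add p q _ _ hp hq =>
    simp only [Pi.add_apply, mul_add]; exact Submodule.add_mem _ hp hq
  | smul c p _ hp =>
    convert Submodule.smul_mem _ c hp using 1
    funext z
    simp only [Pi.smul_apply, smul_eq_mul]; ring

/-- The Taylor coefficients of the slices of a holomorphic function are homogeneous
polynomials. -/
lemma iteratedDeriv_slice_mem (n : ℕ) {f : Cn d → ℂ} {R : ℝ} (hR : 0 < R)
    (hf : DifferentiableOn ℂ f (ball 0 R)) :
    (fun z => iteratedDeriv n (fun t : ℂ => f (t • z)) 0) ∈ homogeneousSpan d n := by
  induction n generalizing f with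
  | zero =>
    have h1 : monom (0 : Fin d → ℕ) ∈ homogeneousSpan d 0 :=
      Submodule.subset_span ⟨0, by simp, rfl⟩
    convert Submodule.smul_mem _ (f 0) h1 using 1
    funext z
    simp [monom]
  | succ n ih =>
    -- One derivative of the slice is `∑ zᵢ` times the slices of the partial derivatives. The
    -- induction hypothesis applies to these, and each `zᵢ` raises the degree by one.
    have key : (fun z => iteratedDeriv (n + 1) (fun t : ℂ => f (t • z)) 0) =
        ∑ i, fun z : Cn d => z i * iteratedDeriv n
          (fun t : ℂ => fderiv ℂ f (t • z) (EuclideanSpace.single i 1)) 0 := by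
      funext z
      obtain ⟨r, hr, hrz⟩ : ∃ r > 0, r * ‖z‖ ≤ R := by
        refine ⟨R / (‖z‖ + 1), by positivity, ?_⟩
        rw [div_mul_eq_mul_div, div_le_iff₀ (by positivity)]
        nlinarith [norm_nonneg z]
      have hmem : ∀ t ∈ ball (0 : ℂ) r, t • z ∈ ball (0 : Cn d) R := by
        intro t ht
        rw [mem_ball_zero_iff] at ht ⊢
        rw [norm_smul]
        rcases (norm_nonneg z).eq_or_lt with h | h
        · rwa [← h, mul_zero]
        · exact (mul_lt_mul_of_pos_right ht h).trans_le hrz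
      have hev : deriv (fun t : ℂ => f (t • z)) =ᶠ[𝓝 0] fun t => ∑ i, z i *
          fderiv ℂ f (t • z) (EuclideanSpace.single i 1) := by
        filter_upwards [ball_mem_nhds (0 : ℂ) hr] with t ht
        have h0 : HasFDerivAt f (fderiv ℂ f (t • z)) (t • z) :=
          ((hf _ (hmem t ht)).differentiableAt (isOpen_ball.mem_nhds (hmem t ht))).hasFDerivAt
        have h1 : HasDerivAt (fun t : ℂ => t • z) z t := by
          simpa using (hasDerivAt_id t).smul_const z
        rw [show deriv (fun t : ℂ => f (t • z)) t = fderiv ℂ f (t • z) z from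
          (h0.comp_hasDerivAt t h1).deriv]
        have hz : z = ∑ i, z i • EuclideanSpace.single i (1 : ℂ) := by
          ext j; simp [Pi.single_apply]
        have := congrArg (fderiv ℂ f (t • z)) hz
        simpa only [map_sum, map_smul, smul_eq_mul] using this
      rw [iteratedDeriv_succ', hev.iteratedDeriv_eq, iteratedDeriv_fun_sum, Finset.sum_apply]
      · refine Finset.sum_congr rfl fun i _ => ?_
        rw [iteratedDeriv_const_mul_field]
      · intro i _
        have := differentiableOn_slice (differentiableOn_fderiv_apply hf
          (EuclideanSpace.single i 1)) hrz hR
        exact contDiffAt_const.mul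
          ((this.analyticAt (ball_mem_nhds 0 hr)).contDiffAt)
    rw [key]
    exact Submodule.sum_mem _ fun i _ =>
      coord_mul_mem_homogeneousSpan (ih (differentiableOn_fderiv_apply hf _)) i

/-- Functions holomorphic on a neighbourhood of the closed unit ball are uniform limits of
polynomials with the same value at the origin. -/
theorem exists_polynomial_approx {f : Cn d → ℂ} {R : ℝ} (hR : 1 < R)
    (hf : DifferentiableOn ℂ f (ball 0 R)) {η : ℝ} (hη : 0 < η) :
    ∃ p ∈ Submodule.span ℂ (monom '' {α : Fin d → ℕ | α ≠ 0}),
      ∀ z ∈ closedBall (0 : Cn d) 1, ‖f z - (f 0 + p z)‖ < η := by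
  obtain ⟨r, hr1, hrR⟩ := exists_between hR
  have hr0 : 0 < r := by linarith
  have hR0 : 0 < R := by linarith
  obtain ⟨M, hM⟩ := (isCompact_closedBall (0 : Cn d) r).exists_bound_of_continuousOn
    (hf.continuousOn.mono (closedBall_subset_ball hrR))
  -- The homogeneous component of degree `n`, as a Taylor coefficient of the slice `t ↦ f (t z)`.
  -- Cauchy's estimate on the circle of radius `r > 1` gives a geometric majorant, and evaluation at
  -- `t = 1` recovers `f`.
  set a : ℕ → Cn d → ℂ := fun n z =>
    ((n.factorial : ℂ))⁻¹ * iteratedDeriv n (fun t : ℂ => f (t • z)) 0 with ha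
  have hbound : ∀ n, ∀ z ∈ closedBall (0 : Cn d) 1, ‖a n z‖ ≤ M * (r⁻¹) ^ n := by
    intro n z hz
    rw [mem_closedBall_zero_iff] at hz
    have hd : DiffContOnCl ℂ (fun t : ℂ => f (t • z)) (ball 0 r) := by
      refine DifferentiableOn.diffContOnCl_ball (U := ball 0 R) ?_ (closedBall_subset_ball hrR)
      exact differentiableOn_slice hf (by nlinarith) hR0
    have := Complex.norm_iteratedDeriv_le_of_forall_mem_sphere_norm_le n hr0 hd
      (C := M) (fun t ht => hM _ (by
        rw [mem_sphere_zero_iff_norm] at ht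
        rw [mem_closedBall_zero_iff, norm_smul, ht]
        nlinarith))
    have hfac : (0 : ℝ) < n.factorial := by exact_mod_cast n.factorial_pos
    simp only [ha, norm_mul, norm_inv, Complex.norm_natCast]
    rw [inv_mul_le_iff₀ hfac]
    refine this.trans_eq ?_
    rw [inv_pow]; ring
  have hsum : Summable fun n => M * (r⁻¹) ^ n :=
    (summable_geometric_of_lt_one (by positivity) (inv_lt_one_of_one_lt₀ hr1)).mul_left _
  have htend := tendstoUniformlyOn_tsum_nat hsum hbound
  have hval : ∀ z ∈ closedBall (0 : Cn d) 1, ∑' n, a n z = f z := by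
    intro z hz
    rw [mem_closedBall_zero_iff] at hz
    have hd : DifferentiableOn ℂ (fun t : ℂ => f (t • z)) (ball 0 R) :=
      differentiableOn_slice hf (by nlinarith) hR0
    have := Complex.hasSum_taylorSeries_on_ball hd (z := 1) (by simpa using hR)
    simpa [ha] using this.tsum_eq
  -- With `N ≥ 1` the term of degree `0`, which is `f 0`, can be split off, leaving a polynomial
  -- without constant term.
  obtain ⟨N, hN, hN0⟩ :=
    ((Metric.tendstoUniformlyOn_iff.1 htend η hη).and (eventually_ge_atTop 1)).exists
  refine ⟨fun z => ∑ n ∈ Finset.Ico 1 N, a n z, ?_, fun z hz => ?_⟩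
  · have : (fun z => ∑ n ∈ Finset.Ico 1 N, a n z) = ∑ n ∈ Finset.Ico 1 N, a n := by
      funext z; simp
    rw [this]
    refine Submodule.sum_mem _ fun n hn => ?_
    have h1 : a n ∈ homogeneousSpan d n :=
      Submodule.smul_mem _ ((n.factorial : ℂ))⁻¹ (iteratedDeriv_slice_mem n hR0 hf)
    refine Submodule.span_mono (Set.image_mono fun α hα => ?_) h1
    rintro rfl
    have hα : ∑ i : Fin d, (0 : Fin d → ℕ) i = n := hα
    simp at hα
    have := (Finset.mem_Ico.1 hn).1
    omega
  · have := hN z hz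
    rw [hval z hz, dist_eq_norm, Finset.range_eq_Ico, Finset.sum_eq_sum_Ico_succ_bot hN0] at this
    simpa [ha] using this

end Holomorphic

/-! ### Mean values and radial limits -/

section RadialLimits

variable {d : ℕ}

lemma norm_coe_sphere (ζ : USphere d) : ‖(ζ : Cn d)‖ = 1 := by simp

/-- Radii increasing to `1`. -/
def radius (n : ℕ) : ℝ := 1 - 1 / ((n : ℝ) + 1)

lemma radius_nonneg (n : ℕ) : 0 ≤ radius n := by
  have : 1 / ((n : ℝ) + 1) ≤ 1 := by
    rw [div_le_one (by positivity)]; linarith [n.cast_nonneg (α := ℝ)]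
  unfold radius; linarith

lemma radius_pos {n : ℕ} (hn : 1 ≤ n) : 0 < radius n := by
  have h : (1 : ℝ) ≤ n := by exact_mod_cast hn
  have : 1 / ((n : ℝ) + 1) < 1 := by
    rw [div_lt_one (by positivity)]; linarith
  unfold radius; linarith

lemma radius_lt_one (n : ℕ) : radius n < 1 := by
  have : 0 < 1 / ((n : ℝ) + 1) := by positivity
  unfold radius; linarith

lemma tendsto_radius : Tendsto radius atTop (𝓝 1) := by
  have := (tendsto_one_div_add_atTop_nhds_zero_nat (𝕜 := ℝ)).const_sub 1
  rw [sub_zero] at this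
  exact this

lemma radius_smul_mem_ball (n : ℕ) {z : Cn d} (hz : z ∈ closedBall (0 : Cn d) 1) :
    (radius n : ℂ) • z ∈ ball (0 : Cn d) 1 := by
  rw [mem_closedBall_zero_iff] at hz
  rw [mem_ball_zero_iff, norm_smul, Complex.norm_real, Real.norm_of_nonneg (radius_nonneg n)]
  nlinarith [radius_nonneg n, radius_lt_one n, norm_nonneg z]

lemma sphere_mem_closedBall (ζ : USphere d) : (ζ : Cn d) ∈ closedBall (0 : Cn d) 1 := by simp

lemma continuous_radial {H : Cn d → ℂ} (hH : DifferentiableOn ℂ H (ball 0 1)) (n : ℕ) :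
    Continuous fun ζ : USphere d => H ((radius n : ℂ) • (ζ : Cn d)) :=
  hH.continuousOn.comp_continuous (by fun_prop)
    fun ζ => radius_smul_mem_ball n (sphere_mem_closedBall ζ)

lemma integrable_of_continuous_sphere {F : Type*} [NormedAddCommGroup F]
    [SecondCountableTopology F] (ν : Measure (USphere d)) [IsFiniteMeasure ν] {f : USphere d → F}
    (hf : Continuous f) : Integrable f ν := by
  obtain ⟨C, hC⟩ := isCompact_univ.exists_bound_of_continuousOn hf.continuousOn
  exact Integrable.of_bound hf.aestronglyMeasurable C (.of_forall fun x => hC x trivial)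

/-- The mean value property on spheres inside the ball. -/
lemma integral_radial [NeZero d] {H : Cn d → ℂ} (hH : DifferentiableOn ℂ H (ball 0 1)) (n : ℕ) :
    ∫ ζ : USphere d, H ((radius n : ℂ) • (ζ : Cn d)) ∂(sigma d) = H 0 := by
  set r := radius n
  set ν : Measure ℝ := volume.restrict (Set.Ioc 0 (2 * Real.pi)) with hν
  -- Fubini in `(θ, ζ)`: by rotation invariance the integral over `ζ` does not depend on `θ`, while
  -- the one-variable mean value property on each slice gives `2π H 0` for the integral over `θ`.
  set G : ℝ → USphere d → ℂ := fun θ ζ => H (circleMap 0 r θ • (ζ : Cn d)) with hG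
  have hmem : ∀ θ (ζ : USphere d), circleMap 0 r θ • (ζ : Cn d) ∈ closedBall (0 : Cn d) r := by
    intro θ ζ
    rw [mem_closedBall_zero_iff, norm_smul, norm_circleMap_zero, norm_coe_sphere, mul_one,
      abs_of_nonneg (radius_nonneg n)]
  have hsub : closedBall (0 : Cn d) r ⊆ ball 0 1 := closedBall_subset_ball (radius_lt_one n)
  have hcont : Continuous (Function.uncurry G) :=
    hH.continuousOn.comp_continuous (by fun_prop) fun x => hsub (hmem x.1 x.2)
  obtain ⟨C, hC⟩ := (isCompact_closedBall (0 : Cn d) r).exists_bound_of_continuousOn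
    (hH.continuousOn.mono hsub)
  have hint : Integrable (Function.uncurry G) (ν.prod (sigma d)) :=
    Integrable.of_bound hcont.aestronglyMeasurable C (.of_forall fun x => hC _ (hmem x.1 x.2))
  have h1 : ∀ θ, ∫ ζ, G θ ζ ∂(sigma d) = ∫ ζ : USphere d, H ((r : ℂ) • (ζ : Cn d)) ∂(sigma d) := by
    intro θ
    rw [← integral_sphereMap (torusIsometry fun _ => Circle.exp θ)
      (fun ζ : USphere d => H ((r : ℂ) • (ζ : Cn d)))]
    refine integral_congr_ae (.of_forall fun ζ => ?_)
    simp only [hG, coe_sphereMap, torusIsometry_const, smul_smul, circleMap_zero, Circle.coe_exp]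
  have h2 : ∀ ζ, ∫ θ, G θ ζ ∂ν = 2 * Real.pi * H 0 := by
    intro ζ
    have hd : DiffContOnCl ℂ (fun t : ℂ => H (t • (ζ : Cn d))) (ball 0 |r|) := by
      rw [abs_of_nonneg (radius_nonneg n)]
      exact (differentiableOn_slice hH (r := 1) (by simp) one_pos).diffContOnCl_ball
        (closedBall_subset_ball (radius_lt_one n))
    have := hd.circleAverage
    rw [Real.circleAverage, intervalIntegral.integral_of_le Real.two_pi_pos.le, zero_smul,
      inv_smul_eq_iff₀ Real.two_pi_pos.ne'] at this
    rw [hν, this]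
    simp
  have hswap := integral_integral_swap hint
  simp only [h1, h2, integral_const, probReal_univ, one_smul] at hswap
  have hm : ν.real Set.univ = 2 * Real.pi := by
    simp [hν, Real.two_pi_pos.le]
  rw [hm, Complex.real_smul] at hswap
  have hpi : ((2 * Real.pi : ℝ) : ℂ) ≠ 0 := by exact_mod_cast Real.two_pi_pos.ne'
  exact mul_left_cancel₀ hpi (by rw [hswap]; push_cast; ring)

/-- The mean value property for the radial limits of a bounded holomorphic function. -/
lemma integral_radialLimit [NeZero d] {H : Cn d → ℂ} (hH : DifferentiableOn ℂ H (ball 0 1))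
    {C : ℝ} (hC : ∀ z ∈ ball (0 : Cn d) 1, ‖H z‖ ≤ C) {Hs : USphere d → ℂ}
    (hlim : ∀ᵐ ζ : USphere d ∂(sigma d),
      Tendsto (fun n => H ((radius n : ℂ) • (ζ : Cn d))) atTop (𝓝 (Hs ζ))) :
    ∫ ζ, Hs ζ ∂(sigma d) = H 0 := by
  have h := tendsto_integral_of_dominated_convergence (fun _ => C)
    (fun n => (continuous_radial hH n).aestronglyMeasurable) (integrable_const C)
    (fun n => .of_forall fun ζ => hC _ (radius_smul_mem_ball n (sphere_mem_closedBall ζ))) hlim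
  simp only [integral_radial hH] at h
  exact tendsto_nhds_unique h tendsto_const_nhds

/-- A `K`-limit is a radial limit. -/
lemma HasKLimit.tendsto_radial {g : Cn d → ℂ} {ζ : USphere d} {c : ℂ} (h : HasKLimit g ζ c) :
    Tendsto (fun n => g ((radius n : ℂ) • (ζ : Cn d))) atTop (𝓝 c) := by
  -- At `z = rζ` the Korányi condition reads `1 - r < (a / 2) (1 - r²)`. An aperture above `2`
  -- admits every `0 ≤ r < 1`, including `radius 0 = 0`.
  refine (h 3 (by norm_num)).comp (tendsto_nhdsWithin_iff.2 ⟨?_, .of_forall fun n => ?_⟩)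
  · have : Tendsto (fun n => (radius n : ℂ) • (ζ : Cn d)) atTop (𝓝 (((1 : ℝ) : ℂ) • (ζ : Cn d))) :=
      ((Complex.continuous_ofReal.tendsto 1).comp tendsto_radius).smul_const _
    simpa using this
  · refine ⟨radius_smul_mem_ball n (sphere_mem_closedBall ζ), ?_⟩
    have h0 := radius_nonneg n
    have h1 := radius_lt_one n
    have : (inner ℂ (ζ : Cn d) (ζ : Cn d) : ℂ) = 1 := by
      rw [inner_self_eq_norm_sq_to_K]; simp
    rw [inner_smul_right, this, mul_one, norm_smul, Complex.norm_real, norm_coe_sphere,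
      Real.norm_of_nonneg h0, mul_one, ← Complex.ofReal_one, ← Complex.ofReal_sub,
      Complex.norm_real, Real.norm_of_nonneg (by linarith)]
    nlinarith

/-- Since the default value is `0`, a nonzero boundary value certifies that the `K`-limit exists.
The lower bound on `w` thus provides the boundary values almost everywhere. -/
lemma hasKLimit_boundaryValue {g : Cn d → ℂ} {ζ : USphere d} (h : boundaryValue g ζ ≠ 0) :
    HasKLimit g ζ (boundaryValue g ζ) := by
  unfold boundaryValue at h ⊢
  split_ifs at h ⊢ with h'
  · exact h'.choose_spec
  · exact absurd rfl h

lemma aemeasurable_of_radialLimit {H : Cn d → ℂ} (hH : DifferentiableOn ℂ H (ball 0 1))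
    {Hs : USphere d → ℂ} (hlim : ∀ᵐ ζ : USphere d ∂(sigma d),
      Tendsto (fun n => H ((radius n : ℂ) • (ζ : Cn d))) atTop (𝓝 (Hs ζ))) :
    AEMeasurable Hs (sigma d) :=
  aemeasurable_of_tendsto_metrizable_ae atTop
    (fun n => (continuous_radial hH n).measurable.aemeasurable) hlim

/-- Analytic polynomials without constant term. -/
def polySpan (d : ℕ) : Submodule ℂ (Cn d → ℂ) :=
  Submodule.span ℂ (monom '' {α : Fin d → ℕ | α ≠ 0})

lemma differentiable_monom (α : Fin d → ℕ) : Differentiable ℂ (monom α) := by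
  unfold monom
  fun_prop

lemma polySpan_spec {p : Cn d → ℂ} (hp : p ∈ polySpan d) : Differentiable ℂ p ∧ p 0 = 0 := by
  induction hp using Submodule.span_induction with
  | mem p hp =>
    obtain ⟨α, hα, rfl⟩ := hp
    obtain ⟨i, hi⟩ := Function.ne_iff.1 hα
    exact ⟨differentiable_monom α, Finset.prod_eq_zero (Finset.mem_univ i) (by simpa using hi)⟩
  | zero => exact ⟨differentiable_const _, rfl⟩
  | add p q _ _ hp hq => exact ⟨hp.1.add hq.1, by simp [hp.2, hq.2]⟩
  | smul c p _ hp => exact ⟨hp.1.const_smul c, by simp [hp.2]⟩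

/-- The variance is nonnegative. -/
lemma sq_integral_le_integral_sq {X : Type*} [MeasurableSpace X] {ν : Measure X}
    [IsProbabilityMeasure ν] {f : X → ℝ} (hf : Integrable f ν)
    (hf2 : Integrable (fun x => f x ^ 2) ν) : (∫ x, f x ∂ν) ^ 2 ≤ ∫ x, f x ^ 2 ∂ν := by
  set c := ∫ x, f x ∂ν with hc
  have h0 : 0 ≤ ∫ x, (f x - c) ^ 2 ∂ν := integral_nonneg fun x => sq_nonneg _
  have h1 : ∫ x, (f x - c) ^ 2 ∂ν = (∫ x, f x ^ 2 ∂ν) - 2 * c * c + c ^ 2 := by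
    have : ∀ x, (f x - c) ^ 2 = f x ^ 2 - 2 * c * f x + c ^ 2 := fun x => by ring
    simp only [this]
    have h2 : Integrable (fun x => 2 * c * f x) ν := hf.const_mul _
    have h3 : Integrable (fun x => f x ^ 2 - 2 * c * f x) ν := hf2.sub h2
    rw [integral_add h3 (integrable_const _), integral_sub hf2 h2, integral_const_mul, ← hc]
    simp
  nlinarith

lemma norm_le_norm_add_ofReal {u : ℂ} (hu : 0 ≤ u.re) {δ : ℝ} (hδ : 0 ≤ δ) : ‖u‖ ≤ ‖u + δ‖ := by
  rw [← sq_le_sq₀ (norm_nonneg _) (norm_nonneg _), Complex.sq_norm, Complex.sq_norm,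
    Complex.normSq_apply, Complex.normSq_apply]
  simp only [Complex.add_re, Complex.ofReal_re, Complex.add_im, Complex.ofReal_im, add_zero]
  nlinarith

lemma le_norm_add_ofReal {u : ℂ} (hu : 0 ≤ u.re) {δ : ℝ} : δ ≤ ‖u + δ‖ := by
  have h := Complex.re_le_norm (u + δ)
  simp only [Complex.add_re, Complex.ofReal_re] at h
  linarith

end RadialLimits

/-! ### Logarithmic and quadratic means of functions with nonnegative real part -/

section NonnegRe

variable {d : ℕ} [NeZero d] {g : Cn d → ℂ} {gs : USphere d → ℂ}

/-- Since `Re (g + δ) ≥ δ`, the principal logarithm of `g + δ` is holomorphic and bounded. The claim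
is the real part of its mean value property. -/
lemma integral_log_norm_add (hg : DifferentiableOn ℂ g (ball 0 1))
    (hg_norm : ∀ z ∈ ball (0 : Cn d) 1, ‖g z‖ ≤ 1)
    (hg_re : ∀ z ∈ ball (0 : Cn d) 1, 0 ≤ (g z).re)
    (hlim : ∀ᵐ ζ : USphere d ∂(sigma d),
      Tendsto (fun n => g ((radius n : ℂ) • (ζ : Cn d))) atTop (𝓝 (gs ζ)))
    (hre : ∀ᵐ ζ ∂(sigma d), 0 ≤ (gs ζ).re) (hn : ∀ᵐ ζ ∂(sigma d), ‖gs ζ‖ ≤ 1)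
    {δ : ℝ} (hδ : 0 < δ) :
    ∫ ζ, Real.log ‖gs ζ + δ‖ ∂(sigma d) = Real.log ‖g 0 + δ‖ := by
  have hslit : ∀ u : ℂ, 0 ≤ u.re → u + δ ∈ Complex.slitPlane := fun u hu =>
    Or.inl (by simpa using by linarith)
  have hbd : ∀ u : ℂ, 0 ≤ u.re → ‖u‖ ≤ 1 →
      ‖Complex.log (u + δ)‖ ≤ |Real.log δ| + |Real.log (1 + δ)| + Real.pi := by
    intro u hu hu1
    have h1 : δ ≤ ‖u + δ‖ := le_norm_add_ofReal hu
    have h2 : ‖u + δ‖ ≤ 1 + δ := by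
      refine (norm_add_le _ _).trans ?_
      rw [Complex.norm_real, Real.norm_of_nonneg hδ.le]; linarith
    have h3 := Real.log_le_log hδ h1
    have h4 := Real.log_le_log (hδ.trans_le h1) h2
    have h5 : |Real.log ‖u + δ‖| ≤ |Real.log δ| + |Real.log (1 + δ)| :=
      abs_le.2 ⟨by linarith [neg_abs_le (Real.log δ), abs_nonneg (Real.log (1 + δ))],
        by linarith [le_abs_self (Real.log (1 + δ)), abs_nonneg (Real.log δ)]⟩
    refine (Complex.norm_le_abs_re_add_abs_im _).trans ?_
    rw [Complex.log_re, Complex.log_im]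
    linarith [Complex.abs_arg_le_pi (u + δ)]
  have hH : DifferentiableOn ℂ (fun z => Complex.log (g z + δ)) (ball 0 1) :=
    (hg.add_const _).clog fun z hz => hslit _ (hg_re z hz)
  have hHlim : ∀ᵐ ζ : USphere d ∂(sigma d),
      Tendsto (fun n => Complex.log (g ((radius n : ℂ) • (ζ : Cn d)) + δ)) atTop
        (𝓝 (Complex.log (gs ζ + δ))) := by
    filter_upwards [hlim, hre] with ζ h1 h2
    exact (h1.add_const (δ : ℂ)).clog (hslit _ h2)
  have hmean := integral_radialLimit hH
    (fun z hz => hbd (g z) (hg_re z hz) (hg_norm z hz)) hHlim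
  have hint : Integrable (fun ζ => Complex.log (gs ζ + δ)) (sigma d) := by
    refine Integrable.of_bound (aemeasurable_of_radialLimit hH hHlim).aestronglyMeasurable
      (|Real.log δ| + |Real.log (1 + δ)| + Real.pi) ?_
    filter_upwards [hre, hn] with ζ h1 h2 using hbd _ h1 h2
  have := integral_re hint
  simp only [RCLike.re_to_complex, Complex.log_re] at this
  rw [this, hmean, Complex.log_re]

/-- A bounded holomorphic function with nonnegative real part is outer. -/
lemma exp_integral_log_norm (hg : DifferentiableOn ℂ g (ball 0 1))
    (hg_norm : ∀ z ∈ ball (0 : Cn d) 1, ‖g z‖ ≤ 1)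
    (hg_re : ∀ z ∈ ball (0 : Cn d) 1, 0 ≤ (g z).re)
    (hlim : ∀ᵐ ζ : USphere d ∂(sigma d),
      Tendsto (fun n => g ((radius n : ℂ) • (ζ : Cn d))) atTop (𝓝 (gs ζ)))
    (hre : ∀ᵐ ζ ∂(sigma d), 0 ≤ (gs ζ).re) (hn : ∀ᵐ ζ ∂(sigma d), ‖gs ζ‖ ≤ 1)
    {c : ℝ} (hc : 0 < c) (hcn : ∀ᵐ ζ ∂(sigma d), c ≤ ‖gs ζ‖) :
    Real.exp (∫ ζ, Real.log ‖gs ζ‖ ∂(sigma d)) = ‖g 0‖ := by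
  have hm := aemeasurable_of_radialLimit hg hlim
  set δ : ℕ → ℝ := fun n => 1 / ((n : ℝ) + 1) with hδ
  have hδ0 : ∀ n, 0 < δ n := fun n => by positivity
  have hδ1 : ∀ n, δ n ≤ 1 := fun n => by
    rw [hδ]; simp only; rw [div_le_one (by positivity)]; linarith [n.cast_nonneg (α := ℝ)]
  have hδlim : Tendsto (fun n => (δ n : ℂ)) atTop (𝓝 0) := by
    have := (Complex.continuous_ofReal.tendsto 0).comp
      (tendsto_one_div_add_atTop_nhds_zero_nat (𝕜 := ℝ))
    simpa [hδ, Function.comp_def] using this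
  have hconv : Tendsto (fun n => ∫ ζ, Real.log ‖gs ζ + δ n‖ ∂(sigma d)) atTop
      (𝓝 (∫ ζ, Real.log ‖gs ζ‖ ∂(sigma d))) := by
    -- The dominating constant comes from `c ≤ |gs| ≤ |gs + δ n| ≤ 2`.
    refine tendsto_integral_of_dominated_convergence (fun _ => |Real.log c| + Real.log 2)
      (fun n => ?_) (integrable_const _) (fun n => ?_) ?_
    · exact (Real.measurable_log.comp_aemeasurable (hm.add_const _).norm).aestronglyMeasurable
    · filter_upwards [hre, hn, hcn] with ζ h1 h2 h3
      have h4 : ‖gs ζ‖ ≤ ‖gs ζ + δ n‖ :=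
        norm_le_norm_add_ofReal h1 (hδ0 n).le
      have h5 : ‖gs ζ + δ n‖ ≤ 2 := by
        refine (norm_add_le _ _).trans ?_
        rw [Complex.norm_real, Real.norm_of_nonneg (hδ0 n).le]; linarith [hδ1 n]
      have h6 := Real.log_le_log hc (h3.trans h4)
      have h7 := Real.log_le_log (hc.trans_le (h3.trans h4)) h5
      rw [Real.norm_eq_abs, abs_le]
      exact ⟨by linarith [neg_abs_le (Real.log c), Real.log_pos one_lt_two],
        by linarith [abs_nonneg (Real.log c)]⟩
    · filter_upwards [hcn] with ζ h3
      have : Tendsto (fun n => ‖gs ζ + δ n‖) atTop (𝓝 ‖gs ζ‖) := by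
        simpa using (hδlim.const_add (gs ζ)).norm
      exact this.log (hc.trans_le h3).ne'
  have h1 : Tendsto (fun n => ‖g 0 + δ n‖) atTop
      (𝓝 (Real.exp (∫ ζ, Real.log ‖gs ζ‖ ∂(sigma d)))) := by
    refine ((Real.continuous_exp.tendsto _).comp hconv).congr fun n => ?_
    rw [Function.comp_apply, integral_log_norm_add hg hg_norm hg_re hlim hre hn (hδ0 n),
      Real.exp_log]
    exact (hδ0 n).trans_le (le_norm_add_ofReal (hg_re 0 (by simp)))
  have h2 : Tendsto (fun n => ‖g 0 + δ n‖) atTop (𝓝 ‖g 0‖) := by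
    simpa using (hδlim.const_add (g 0)).norm
  exact tendsto_nhds_unique h1 h2

/-- The lower bound for the weighted distance of `1` to the polynomials without constant term. -/
lemma sq_norm_le_integral (hg : DifferentiableOn ℂ g (ball 0 1))
    (hg_norm : ∀ z ∈ ball (0 : Cn d) 1, ‖g z‖ ≤ 1)
    (hlim : ∀ᵐ ζ : USphere d ∂(sigma d),
      Tendsto (fun n => g ((radius n : ℂ) • (ζ : Cn d))) atTop (𝓝 (gs ζ)))
    (hn : ∀ᵐ ζ ∂(sigma d), ‖gs ζ‖ ≤ 1) {p : Cn d → ℂ} (hp : p ∈ polySpan d) :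
    ‖g 0‖ ^ 2 ≤ ∫ ζ : USphere d, ‖1 + p ζ‖ ^ 2 * ‖gs ζ‖ ^ 2 ∂(sigma d) := by
  obtain ⟨hpd, hp0⟩ := polySpan_spec hp
  -- As `p 0 = 0`, this function has value `g 0` at the origin, hence mean `g 0` over the sphere.
  -- The bound is then Cauchy–Schwarz.
  have hH : DifferentiableOn ℂ (fun z => (1 + p z) * g z) (ball 0 1) :=
    ((differentiable_const _).add hpd).differentiableOn.mul hg
  have hpc : Continuous fun z => 1 + p z := continuous_const.add hpd.continuous
  obtain ⟨C, hC⟩ := (isCompact_closedBall (0 : Cn d) 1).exists_bound_of_continuousOn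
    hpc.continuousOn
  have hC0 : 0 ≤ C := (norm_nonneg _).trans (hC 0 (by simp))
  have hHb : ∀ z ∈ ball (0 : Cn d) 1, ‖(1 + p z) * g z‖ ≤ C := by
    intro z hz
    rw [norm_mul]
    calc _ ≤ C * 1 := mul_le_mul (hC z (ball_subset_closedBall hz)) (hg_norm z hz)
          (norm_nonneg _) hC0
      _ = C := mul_one C
  have hHlim : ∀ᵐ ζ : USphere d ∂(sigma d), Tendsto
      (fun n => (1 + p ((radius n : ℂ) • (ζ : Cn d))) * g ((radius n : ℂ) • (ζ : Cn d))) atTop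
        (𝓝 ((1 + p ζ) * gs ζ)) := by
    filter_upwards [hlim] with ζ h
    have : Tendsto (fun n => (radius n : ℂ) • (ζ : Cn d)) atTop (𝓝 (((1 : ℝ) : ℂ) • (ζ : Cn d))) :=
      ((Complex.continuous_ofReal.tendsto 1).comp tendsto_radius).smul_const _
    rw [Complex.ofReal_one, one_smul] at this
    exact ((hpc.tendsto _).comp this).mul h
  have hmean := integral_radialLimit hH hHb hHlim
  simp only [hp0, add_zero, one_mul] at hmean
  have hm := (aemeasurable_of_radialLimit hH hHlim).norm
  have hb : ∀ᵐ ζ : USphere d ∂(sigma d), ‖(1 + p ζ) * gs ζ‖ ≤ C := by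
    filter_upwards [hn] with ζ h
    rw [norm_mul]
    calc _ ≤ C * 1 := mul_le_mul (hC ζ (sphere_mem_closedBall ζ)) h (norm_nonneg _) hC0
      _ = C := mul_one C
  have hi : Integrable (fun ζ : USphere d => ‖(1 + p ζ) * gs ζ‖) (sigma d) :=
    Integrable.of_bound hm.aestronglyMeasurable C (hb.mono fun ζ h => by simpa using h)
  have hi2 : Integrable (fun ζ : USphere d => ‖(1 + p ζ) * gs ζ‖ ^ 2) (sigma d) := by
    refine Integrable.of_bound (hm.pow_const 2).aestronglyMeasurable (C ^ 2)
      (hb.mono fun ζ h => ?_)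
    rw [Real.norm_of_nonneg (by positivity)]
    exact pow_le_pow_left₀ (norm_nonneg _) h 2
  calc ‖g 0‖ ^ 2 ≤ (∫ ζ : USphere d, ‖(1 + p ζ) * gs ζ‖ ∂(sigma d)) ^ 2 := by
        rw [← hmean]
        exact pow_le_pow_left₀ (norm_nonneg _) (norm_integral_le_integral_norm _) 2
    _ ≤ _ := sq_integral_le_integral_sq hi hi2
    _ = _ := by simp only [norm_mul, mul_pow]

end NonnegRe

/-! ### The extremal problem -/

section Extremal

/-- A finite discrete measure is carried by a finite set up to a small error. -/
lemma IsDiscreteMeasure.exists_finset {X : Type*} [MeasurableSpace X] [MeasurableSingletonClass X]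
    {ν : Measure X} [IsFiniteMeasure ν] (h : IsDiscreteMeasure ν) {η : ℝ} (hη : 0 < η) :
    ∃ F : Finset X, ν.real (F : Set X)ᶜ < η := by
  classical
  obtain ⟨S, hS, hS0⟩ := h
  rcases S.eq_empty_or_nonempty with rfl | hne
  · refine ⟨∅, ?_⟩
    rw [Finset.coe_empty, Measure.real, hS0]
    simpa
  obtain ⟨f, rfl⟩ := hS.exists_eq_range hne
  set F : ℕ → Finset X := fun n => (Finset.range n).image f with hF
  have hanti : Antitone fun n => ((F n : Set X))ᶜ := by
    intro m n hmn
    refine Set.compl_subset_compl.2 ?_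
    exact_mod_cast Finset.image_subset_image (Finset.range_mono hmn)
  have hInter : ⋂ n, ((F n : Set X))ᶜ = (Set.range f)ᶜ := by
    rw [← Set.compl_iUnion]
    congr 1
    ext x
    simp only [hF, Set.mem_iUnion, Finset.coe_image, Set.mem_image, Finset.coe_range,
      Set.mem_Iio, Set.mem_range]
    exact ⟨fun ⟨_, i, _, h⟩ => ⟨i, h⟩, fun ⟨i, h⟩ => ⟨i + 1, i, Nat.lt_succ_self i, h⟩⟩
  have ht := tendsto_measure_iInter_atTop (μ := ν)
    (fun n => ((F n).measurableSet.compl).nullMeasurableSet) hanti ⟨0, measure_ne_top _ _⟩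
  rw [hInter, hS0] at ht
  have ht' := (ENNReal.tendsto_toReal ENNReal.zero_ne_top).comp ht
  obtain ⟨n, hn⟩ := (ht'.eventually (gt_mem_nhds (by simpa using hη))).exists
  exact ⟨F n, hn⟩

/-! ### Polynomials peaking at boundary points -/

variable {d : ℕ}

/-- A polynomial in `z` that peaks at `ξ`. -/
def peak (ξ : USphere d) (z : Cn d) : ℂ :=
  innerSL ℂ (ξ : Cn d) z * (1 + innerSL ℂ (ξ : Cn d) z) / 2

lemma differentiable_peak (ξ : USphere d) : Differentiable ℂ (peak ξ) := by
  have h : Differentiable ℂ (innerSL ℂ (ξ : Cn d)) := (innerSL ℂ (ξ : Cn d)).differentiable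
  unfold peak
  simp only [div_eq_inv_mul]
  exact (h.fun_mul (h.const_add 1)).const_mul _

lemma norm_innerSL_le_one (ξ : USphere d) {z : Cn d} (hz : z ∈ closedBall (0 : Cn d) 1) :
    ‖innerSL ℂ (ξ : Cn d) z‖ ≤ 1 := by
  rw [mem_closedBall_zero_iff] at hz
  refine (norm_inner_le_norm (𝕜 := ℂ) (ξ : Cn d) z).trans ?_
  rwa [norm_coe_sphere, one_mul]

lemma norm_peak_le_one (ξ : USphere d) {z : Cn d} (hz : z ∈ closedBall (0 : Cn d) 1) :
    ‖peak ξ z‖ ≤ 1 := by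
  have h := norm_innerSL_le_one ξ hz
  have h2 : ‖1 + innerSL ℂ (ξ : Cn d) z‖ ≤ 2 :=
    (norm_add_le _ _).trans (by rw [norm_one]; linarith)
  rw [peak, norm_div, norm_mul, Complex.norm_two, div_le_one two_pos]
  nlinarith [norm_nonneg (1 + innerSL ℂ (ξ : Cn d) z), norm_nonneg (innerSL ℂ (ξ : Cn d) z)]

@[simp] lemma peak_zero (ξ : USphere d) : peak ξ 0 = 0 := by simp [peak]

lemma innerSL_self_sphere (ξ : USphere d) : innerSL ℂ (ξ : Cn d) (ξ : Cn d) = 1 := by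
  rw [innerSL_apply_apply, inner_self_eq_norm_sq_to_K]; simp

@[simp] lemma peak_self (ξ : USphere d) : peak ξ ξ = 1 := by
  rw [peak, innerSL_self_sphere]; norm_num

/-- The inner product `t` alone has modulus `1` on the whole circle through `ξ`. The factor `(1 + t)
/ 2` singles out `t = 1`, which forces `ζ = ξ` by the equality case of Cauchy–Schwarz. -/
lemma norm_peak_lt_one {ξ ζ : USphere d} (h : ζ ≠ ξ) : ‖peak ξ ζ‖ < 1 := by
  have h1 := norm_innerSL_le_one ξ (sphere_mem_closedBall ζ)
  set t := innerSL ℂ (ξ : Cn d) (ζ : Cn d) with ht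
  have hne : t ≠ 1 := by
    intro h'
    rw [ht, innerSL_apply_apply, inner_eq_one_iff_of_norm_eq_one (norm_coe_sphere ξ)
      (norm_coe_sphere ζ)] at h'
    exact h (Subtype.ext h'.symm)
  have h2 : ‖1 + t‖ < 2 := by
    have hsq : ‖1 + t‖ ^ 2 < 4 := by
      have e1 : ‖1 + t‖ ^ 2 = 1 + 2 * t.re + ‖t‖ ^ 2 := by
        rw [Complex.sq_norm, Complex.sq_norm, Complex.normSq_apply, Complex.normSq_apply]
        simp; ring
      have e2 : ‖t‖ ^ 2 ≤ 1 := by nlinarith [norm_nonneg t]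
      have e3 : t.re < 1 := by
        refine lt_of_le_of_ne ((Complex.re_le_norm t).trans h1) fun hre => hne ?_
        have : ‖t‖ ^ 2 = t.re * t.re + t.im * t.im := by
          rw [Complex.sq_norm, Complex.normSq_apply]
        refine Complex.ext hre ?_
        rw [Complex.one_im]
        rw [hre] at this
        nlinarith
      linarith
    nlinarith [norm_nonneg (1 + t)]
  rw [peak, norm_div, norm_mul, Complex.norm_two, div_lt_one two_pos]
  nlinarith [norm_nonneg (1 + t), norm_nonneg t]

/-- Polynomials with value `1` at the origin that vanish on `F` and tend to `1` off `F`. -/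
def antipeak (F : Finset (USphere d)) (n : ℕ) (z : Cn d) : ℂ :=
  ∏ ξ ∈ F, (1 - peak ξ z ^ (n + 1))

lemma differentiable_antipeak (F : Finset (USphere d)) (n : ℕ) :
    Differentiable ℂ (antipeak F n) := by
  classical
  unfold antipeak
  induction F using Finset.induction_on with
  | empty => simp
  | insert ξ F hξ ih =>
    simp only [Finset.prod_insert hξ]
    exact (((differentiable_peak ξ).fun_pow (n + 1)).const_sub 1).fun_mul ih

@[simp] lemma antipeak_zero (F : Finset (USphere d)) (n : ℕ) : antipeak F n 0 = 1 := by
  simp [antipeak]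

lemma norm_antipeak_le (F : Finset (USphere d)) (n : ℕ) {z : Cn d}
    (hz : z ∈ closedBall (0 : Cn d) 1) : ‖antipeak F n z‖ ≤ 2 ^ F.card := by
  rw [antipeak, norm_prod]
  refine (Finset.prod_le_prod (g := fun _ => 2) (fun _ _ => norm_nonneg _) fun ξ _ => ?_).trans_eq
    (Finset.prod_const 2)
  refine (norm_sub_le _ _).trans ?_
  rw [norm_one, norm_pow]
  linarith [pow_le_one₀ (n := n + 1) (norm_nonneg _) (norm_peak_le_one ξ hz)]

lemma antipeak_of_mem {F : Finset (USphere d)} (n : ℕ) {ζ : USphere d} (h : ζ ∈ F) :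
    antipeak F n ζ = 0 :=
  Finset.prod_eq_zero h (by simp)

lemma tendsto_antipeak {F : Finset (USphere d)} {ζ : USphere d} (h : ζ ∉ F) :
    Tendsto (fun n => antipeak F n ζ) atTop (𝓝 1) := by
  have : Tendsto (fun n => antipeak F n ζ) atTop (𝓝 (∏ ξ ∈ F, (1 - 0))) := by
    refine tendsto_finsetProd _ fun ξ hξ => Tendsto.const_sub _ ?_
    exact (tendsto_pow_atTop_nhds_zero_of_norm_lt_one
      (norm_peak_lt_one (ne_of_mem_of_not_mem hξ h).symm)).comp (tendsto_add_atTop_nat 1)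
  simpa using this

/-- On the sphere the antipeaks converge boundedly to the indicator of the complement of `F`. -/
lemma tendsto_integral_norm_antipeak_sq (ν : Measure (USphere d)) [IsFiniteMeasure ν]
    (F : Finset (USphere d)) :
    Tendsto (fun n => ∫ ζ : USphere d, ‖antipeak F n ζ‖ ^ 2 ∂ν) atTop
      (𝓝 (ν.real (F : Set (USphere d))ᶜ)) := by
  have hm : MeasurableSet ((F : Set (USphere d))ᶜ) := F.measurableSet.compl
  rw [← integral_indicator_one hm]
  refine tendsto_integral_of_dominated_convergence (fun _ => (2 ^ F.card) ^ 2) (fun n => ?_)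
    (integrable_const _) (fun n => .of_forall fun ζ => ?_) (.of_forall fun ζ => ?_)
  · exact (((differentiable_antipeak F n).continuous.comp
      continuous_subtype_val).norm.pow 2).aestronglyMeasurable
  · rw [Real.norm_of_nonneg (by positivity)]
    exact pow_le_pow_left₀ (norm_nonneg _) (norm_antipeak_le F n (sphere_mem_closedBall ζ)) 2
  · by_cases h : ζ ∈ F
    · simp [antipeak_of_mem _ h, h]
    · simpa [h] using (tendsto_antipeak h).norm.pow 2

variable [NeZero d] {g : Cn d → ℂ} {gs : USphere d → ℂ}

/-- The upper bound for the distance of `1` to the polynomials without constant term. -/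
theorem exists_polynomial_integral_lt (hg : DifferentiableOn ℂ g (ball 0 1))
    (hg_re : ∀ z ∈ ball (0 : Cn d) 1, 0 ≤ (g z).re)
    (hlim : ∀ᵐ ζ : USphere d ∂(sigma d),
      Tendsto (fun n => g ((radius n : ℂ) • (ζ : Cn d))) atTop (𝓝 (gs ζ)))
    (hre : ∀ᵐ ζ ∂(sigma d), 0 ≤ (gs ζ).re) (hn : ∀ᵐ ζ ∂(sigma d), ‖gs ζ‖ ≤ 1)
    {μs μ : Measure (USphere d)} [IsFiniteMeasure μs] [IsProbabilityMeasure μ]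
    (hμs : IsDiscreteMeasure μs)
    (hμ : ∀ f : USphere d → ℝ, Continuous f →
      ∫ ζ, f ζ ∂μ = ∫ ζ, f ζ * ‖gs ζ‖ ^ 2 ∂(sigma d) + ∫ ζ, f ζ ∂μs)
    {η : ℝ} (hη : 0 < η) :
    ∃ p ∈ polySpan d, ∫ ζ : USphere d, ‖1 + p ζ‖ ^ 2 ∂μ < ‖g 0‖ ^ 2 + η := by
  have hg0 := hg_re 0 (by simp)
  obtain ⟨δ, hδ, hδη⟩ : ∃ δ : ℝ, 0 < δ ∧ ‖g 0 + δ‖ ^ 2 < ‖g 0‖ ^ 2 + η / 4 := by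
    have hc : Tendsto (fun δ : ℝ => ‖g 0 + δ‖ ^ 2) (𝓝[>] 0) (𝓝 (‖g 0‖ ^ 2)) := by
      have : Continuous fun δ : ℝ => ‖g 0 + δ‖ ^ 2 := by fun_prop
      simpa using (this.tendsto 0).mono_left nhdsWithin_le_nhds
    obtain ⟨δ, h1, h2⟩ := ((hc.eventually (gt_mem_nhds
      (by linarith : ‖g 0‖ ^ 2 < ‖g 0‖ ^ 2 + η / 4))).and self_mem_nhdsWithin).exists
    exact ⟨δ, h2, h1⟩
  have hgδ : g 0 + δ ≠ 0 := norm_pos_iff.1 (hδ.trans_le (le_norm_add_ofReal hg0))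
  -- A bound for the quotients below that does not depend on the radius, so the finite set `F` can
  -- be fixed before the radius.
  set C : ℝ := ‖g 0 + δ‖ / δ with hC
  have hC0 : 0 < C := div_pos (norm_pos_iff.2 hgδ) hδ
  obtain ⟨F, hF⟩ := hμs.exists_finset (η := η / (4 * C ^ 2)) (by positivity)
  have hF' : C ^ 2 * μs.real (F : Set (USphere d))ᶜ < η / 4 := by
    rw [lt_div_iff₀ (by positivity)] at hF
    linarith
  -- A normalised reciprocal of `g + δ`, with value `1` at the origin. The dilation makes it
  -- holomorphic on a neighbourhood of the closed ball.
  set h : ℕ → Cn d → ℂ := fun n z => (g 0 + δ) / (g ((radius n : ℂ) • z) + δ) with hh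
  have hnorm : ∀ u : ℂ, 0 ≤ u.re → ‖(g 0 + δ) / (u + δ)‖ ≤ C := by
    intro u hu
    rw [norm_div]
    exact div_le_div_of_nonneg_left (norm_nonneg _) hδ (le_norm_add_ofReal hu)
  have hne : ∀ u : ℂ, 0 ≤ u.re → u + δ ≠ 0 :=
    fun u hu => norm_pos_iff.1 (hδ.trans_le (le_norm_add_ofReal hu))
  have hhC : ∀ n (ζ : USphere d), ‖h n ζ‖ ≤ C := fun n ζ =>
    hnorm _ (hg_re _ (radius_smul_mem_ball n (sphere_mem_closedBall ζ)))
  -- The antipeak factor kills the atoms in `F`. It keeps the value at the origin and, `F` being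
  -- `σ`-null, does not affect the limit of the integrals against `σ`.
  set Φ : ℕ → Cn d → ℂ := fun n z => h n z * antipeak F n z with hΦ
  have hhcont : ∀ n, Continuous fun ζ : USphere d => h n ζ := fun n =>
    continuous_const.div ((continuous_radial hg n).add continuous_const)
      fun ζ => hne _ (hg_re _ (radius_smul_mem_ball n (sphere_mem_closedBall ζ)))
  have hacont : ∀ n, Continuous fun ζ : USphere d => antipeak F n ζ := fun n =>
    (differentiable_antipeak F n).continuous.comp continuous_subtype_val
  have hΦcont : ∀ n, Continuous fun ζ : USphere d => Φ n ζ := fun n => (hhcont n).mul (hacont n)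
  have hΦcont2 : ∀ n, Continuous fun ζ : USphere d => ‖Φ n ζ‖ ^ 2 := fun n =>
    (hΦcont n).norm.pow 2
  have hΦB : ∀ n (ζ : USphere d), ‖Φ n ζ‖ ≤ C * 2 ^ F.card := fun n ζ => by
    rw [hΦ, norm_mul]
    exact mul_le_mul (hhC n ζ) (norm_antipeak_le F n (sphere_mem_closedBall ζ)) (norm_nonneg _)
      hC0.le
  set B : ℝ := C * 2 ^ F.card with hB
  have hB0 : 0 < B := by positivity
  -- the absolutely continuous part
  have hlim1 : Tendsto (fun n => ∫ ζ : USphere d, ‖Φ n ζ‖ ^ 2 * ‖gs ζ‖ ^ 2 ∂(sigma d)) atTop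
      (𝓝 (∫ ζ, ‖(g 0 + δ) / (gs ζ + δ)‖ ^ 2 * ‖gs ζ‖ ^ 2 ∂(sigma d))) := by
    have hgsm := aemeasurable_of_radialLimit hg hlim
    refine tendsto_integral_of_dominated_convergence (fun _ => B ^ 2) (fun n => ?_)
      (integrable_const _) (fun n => ?_) ?_
    · exact ((hΦcont2 n).measurable.aemeasurable.mul
        (hgsm.norm.pow_const 2)).aestronglyMeasurable
    · filter_upwards [hn] with ζ h1
      rw [Real.norm_of_nonneg (by positivity)]
      calc ‖Φ n ζ‖ ^ 2 * ‖gs ζ‖ ^ 2 ≤ B ^ 2 * 1 ^ 2 :=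
            mul_le_mul (pow_le_pow_left₀ (norm_nonneg _) (hΦB n ζ) 2)
              (pow_le_pow_left₀ (norm_nonneg _) h1 2) (by positivity) (by positivity)
        _ = B ^ 2 := by ring
    · have hF0 : ∀ᵐ ζ ∂(sigma d), ζ ∉ F := by
        have : sigma d (F : Set (USphere d)) = 0 := F.finite_toSet.measure_zero _
        rw [ae_iff]
        simpa using this
      filter_upwards [hlim, hre, hF0] with ζ h1 h2 h3
      have h4 : Tendsto (fun n => h n ζ) atTop (𝓝 ((g 0 + δ) / (gs ζ + δ))) :=
        tendsto_const_nhds.div (h1.add_const _) (hne _ h2)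
      have h5 := h4.mul (tendsto_antipeak h3)
      rw [mul_one] at h5
      exact (h5.norm.pow 2).mul_const _
  have hle1 : ∫ ζ, ‖(g 0 + δ) / (gs ζ + δ)‖ ^ 2 * ‖gs ζ‖ ^ 2 ∂(sigma d) ≤ ‖g 0 + δ‖ ^ 2 := by
    have : ∫ _ : USphere d, ‖g 0 + δ‖ ^ 2 ∂(sigma d) = ‖g 0 + δ‖ ^ 2 := by simp
    rw [← this]
    refine integral_mono_of_nonneg (.of_forall fun ζ => by positivity) (integrable_const _) ?_
    filter_upwards [hre] with ζ h2
    have h3 := norm_pos_iff.2 (hne _ h2)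
    rw [norm_div, div_pow, div_mul_eq_mul_div, div_le_iff₀ (by positivity)]
    exact mul_le_mul_of_nonneg_left
      (pow_le_pow_left₀ (norm_nonneg _) (norm_le_norm_add_ofReal h2 hδ.le) 2) (by positivity)
  -- the discrete part
  have hlim2 := (tendsto_integral_norm_antipeak_sq μs F).const_mul (C ^ 2)
  have hle2 : ∀ n, ∫ ζ : USphere d, ‖Φ n ζ‖ ^ 2 ∂μs ≤
      C ^ 2 * ∫ ζ : USphere d, ‖antipeak F n ζ‖ ^ 2 ∂μs := by
    intro n
    rw [← integral_const_mul]
    refine integral_mono (integrable_of_continuous_sphere _ (hΦcont2 n))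
      ((integrable_of_continuous_sphere _ ((hacont n).norm.pow 2)).const_mul _) fun ζ => ?_
    simp only [hΦ, norm_mul, mul_pow]
    exact mul_le_mul_of_nonneg_right (pow_le_pow_left₀ (norm_nonneg _) (hhC n ζ) 2)
      (by positivity)
  obtain ⟨n, hnlt, hn1⟩ := (((hlim1.add hlim2).eventually (gt_mem_nhds
    (by linarith : _ < ‖g 0‖ ^ 2 + η / 2))).and (eventually_ge_atTop 1)).exists
  have hΦint : ∫ ζ : USphere d, ‖Φ n ζ‖ ^ 2 ∂μ < ‖g 0‖ ^ 2 + η / 2 := by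
    rw [hμ _ (hΦcont2 n)]
    linarith [hle2 n]
  -- polynomial approximation
  have hr0 := radius_pos hn1
  have hΦd : DifferentiableOn ℂ (Φ n) (ball 0 (radius n)⁻¹) := by
    have hmaps : Set.MapsTo (fun z : Cn d => (radius n : ℂ) • z) (ball 0 (radius n)⁻¹)
        (ball 0 1) := by
      intro z hz
      rw [mem_ball_zero_iff] at hz ⊢
      rw [norm_smul, Complex.norm_real, Real.norm_of_nonneg hr0.le]
      calc radius n * ‖z‖ < radius n * (radius n)⁻¹ := mul_lt_mul_of_pos_left hz hr0
        _ = 1 := mul_inv_cancel₀ hr0.ne'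
    have h1 : DifferentiableOn ℂ (fun z => g ((radius n : ℂ) • z)) (ball 0 (radius n)⁻¹) :=
      hg.comp (by fun_prop) hmaps
    have h2 : DifferentiableOn ℂ (h n) (ball 0 (radius n)⁻¹) :=
      ((h1.add_const (δ : ℂ)).fun_inv fun z hz => hne _ (hg_re _ (hmaps hz))).const_mul _
    exact h2.fun_mul (differentiable_antipeak F n).differentiableOn
  have hΦ0 : Φ n 0 = 1 := by
    simp only [hΦ, hh, smul_zero, antipeak_zero, mul_one]
    exact div_self hgδ
  -- Chosen so that `(|Φ| + κ)² ≤ |Φ|² + κ (2B + κ) ≤ |Φ|² + η / 2`; the cap at `1` serves the last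
  -- inequality.
  set κ : ℝ := min 1 (η / 2 / (2 * B + 1)) with hκ
  have hκ0 : 0 < κ := lt_min one_pos (by positivity)
  have hκ1 : κ ≤ 1 := min_le_left _ _
  have hκ2 : κ * (2 * B + 1) ≤ η / 2 := by
    rw [← le_div_iff₀ (by positivity)]; exact min_le_right _ _
  obtain ⟨p, hp, hpa⟩ := exists_polynomial_approx ((one_lt_inv₀ hr0).2 (radius_lt_one n)) hΦd hκ0
  refine ⟨p, hp, ?_⟩
  have hpc : Continuous fun ζ : USphere d => 1 + p ζ :=
    continuous_const.add ((polySpan_spec hp).1.continuous.comp continuous_subtype_val)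
  have hpt : ∀ ζ : USphere d, ‖1 + p ζ‖ ^ 2 ≤ ‖Φ n ζ‖ ^ 2 + η / 2 := by
    intro ζ
    have h1 := hpa ζ (sphere_mem_closedBall ζ)
    rw [hΦ0] at h1
    have h2 : ‖1 + p ζ‖ ≤ ‖Φ n ζ‖ + κ := by
      have := norm_sub_norm_le (1 + p ζ) (Φ n ζ)
      rw [norm_sub_rev] at this
      linarith
    have h3 := hΦB n ζ
    nlinarith [norm_nonneg (1 + p ζ), norm_nonneg (Φ n ζ)]
  have hi := integrable_of_continuous_sphere μ (hΦcont2 n)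
  calc ∫ ζ : USphere d, ‖1 + p ζ‖ ^ 2 ∂μ ≤ ∫ ζ : USphere d, (‖Φ n ζ‖ ^ 2 + η / 2) ∂μ :=
        integral_mono (integrable_of_continuous_sphere _ (hpc.norm.pow 2))
          (hi.add (integrable_const _)) hpt
    _ = ∫ ζ : USphere d, ‖Φ n ζ‖ ^ 2 ∂μ + η / 2 := by
        rw [integral_add hi (integrable_const _)]; simp
    _ < _ := by linarith

end Extremal

/-! ### Verblunsky coefficients and the extremal problem -/

/-- An infinite product of factors in `[0, 1]` converges to the infimum of its partial products. -/
lemma hasProd_of_forall_le_of_exists_lt {F : ℕ → ℝ} (h0 : ∀ n, 0 ≤ F n) (h1 : ∀ n, F n ≤ 1) {L : ℝ}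
    (hL : ∀ n, L ≤ ∏ i ∈ Finset.range n, F i)
    (hL' : ∀ η > 0, ∃ n, ∏ i ∈ Finset.range n, F i < L + η) : HasProd F L := by
  have hmono : ∀ s t : Finset ℕ, s ⊆ t → ∏ i ∈ t, F i ≤ ∏ i ∈ s, F i := by
    intro s t hst
    rw [← Finset.prod_sdiff hst]
    exact mul_le_of_le_one_left (Finset.prod_nonneg fun i _ => h0 i)
      (Finset.prod_le_one (fun i _ => h0 i) fun i _ => h1 i)
  rw [HasProd, SummationFilter.unconditional_filter, Metric.tendsto_atTop]
  intro η hη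
  obtain ⟨n, hn⟩ := hL' η hη
  refine ⟨Finset.range n, fun s hs => ?_⟩
  obtain ⟨N, hN⟩ := s.exists_nat_subset_range
  have h2 := (hL N).trans (hmono _ _ hN)
  have h3 := hmono _ _ hs
  rw [Real.dist_eq, abs_lt]
  constructor <;> linarith

section Moments

variable {d : ℕ} (μ : Measure (USphere d)) [IsProbabilityMeasure μ]

/-- The conjugate of a monomial as a continuous function on the sphere. -/
def conjMonom (α : Fin d → ℕ) : C(USphere d, ℂ) :=
  ⟨fun ζ => conj (monom α ζ),
    Complex.continuous_conj.comp ((continuous_monom α).comp continuous_subtype_val)⟩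

/-- The vectors in `L²(μ)` whose Gram kernel is the moment kernel. -/
def momentVector (n : ℕ) : Lp ℂ 2 μ :=
  ContinuousMap.toLp 2 μ ℂ (conjMonom (shortlexNth d n))

/-- Mathlib's inner product is conjugate-linear in its first argument. Conjugated monomials
therefore yield `K(n, m)` rather than its conjugate. -/
lemma inner_momentVector (n m : ℕ) : inner ℂ (momentVector μ n) (momentVector μ m) =
    momentKernel μ (shortlexNth d n) (shortlexNth d m) := by
  rw [momentVector, momentVector, ContinuousMap.inner_toLp, momentKernel]
  refine integral_congr_ae (.of_forall fun ζ => ?_)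
  simp only [conjMonom, ContinuousMap.coe_mk, Complex.conj_conj, monom]
  ring

lemma norm_toLp_sq (f : C(USphere d, ℂ)) :
    ‖ContinuousMap.toLp 2 μ ℂ f‖ ^ 2 = ∫ ζ, ‖f ζ‖ ^ 2 ∂μ := by
  have h := inner_self_eq_norm_sq (𝕜 := ℂ) (ContinuousMap.toLp 2 μ ℂ f)
  rw [ContinuousMap.inner_toLp] at h
  have h2 : ∀ ζ, f ζ * conj (f ζ) = ((‖f ζ‖ ^ 2 : ℝ) : ℂ) := fun ζ => by
    rw [Complex.mul_conj, Complex.normSq_eq_norm_sq]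
  simp only [h2, integral_complex_ofReal] at h
  exact h.symm

variable {μ} [NeZero d]

/-- A linear relation in `L²(μ)` holds `μ`-a.e., hence `σ`-a.e. Orthogonality of the monomials under
`σ` then isolates each coefficient, and a monomial has nonzero norm in `L²(σ)`. -/
lemma linearIndependent_momentVector (hσ : sigma d ≪ μ) :
    LinearIndependent ℂ (momentVector μ) := by
  rw [linearIndependent_iff']
  intro s a ha j hj
  have hae : ∀ᵐ ζ ∂(sigma d), ∑ i ∈ s, a i * conjMonom (shortlexNth d i) ζ = 0 := by
    have h1 : ContinuousMap.toLp 2 μ ℂ (∑ i ∈ s, a i • conjMonom (shortlexNth d i)) = 0 := by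
      rw [map_sum, ← ha]
      exact Finset.sum_congr rfl fun i _ => map_smul _ _ _
    have h2 := ContinuousMap.coeFn_toLp (p := 2) (𝕜 := ℂ) μ
      (∑ i ∈ s, a i • conjMonom (shortlexNth d i))
    rw [h1] at h2
    refine hσ.ae_le ?_
    filter_upwards [h2, Lp.coeFn_zero ℂ 2 μ] with ζ h3 h4
    rw [h4] at h3
    simpa using h3.symm
  have hint : ∀ i, Integrable (fun ζ : USphere d => a i *
      (monom (shortlexNth d j) ζ * conj (monom (shortlexNth d i) ζ))) (sigma d) := fun i =>
    (integrable_of_continuous_sphere _ (((continuous_monom _).comp continuous_subtype_val).mul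
      (Complex.continuous_conj.comp
        ((continuous_monom _).comp continuous_subtype_val)))).const_mul _
  have h0 : ∑ i ∈ s, a i * ∫ ζ : USphere d,
      monom (shortlexNth d j) ζ * conj (monom (shortlexNth d i) ζ) ∂(sigma d) = 0 := by
    simp only [← integral_const_mul]
    rw [← integral_finsetSum _ fun i _ => hint i]
    refine integral_eq_zero_of_ae ?_
    filter_upwards [hae] with ζ h
    have : ∑ i ∈ s, a i * (monom (shortlexNth d j) (ζ : Cn d) *
        conj (monom (shortlexNth d i) (ζ : Cn d))) =
        monom (shortlexNth d j) (ζ : Cn d) * ∑ i ∈ s, a i * conjMonom (shortlexNth d i) ζ := by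
      rw [Finset.mul_sum]
      refine Finset.sum_congr rfl fun i _ => ?_
      simp only [conjMonom, ContinuousMap.coe_mk]
      ring
    rw [this, h, mul_zero, Pi.zero_apply]
  rw [Finset.sum_eq_single j] at h0
  · refine (mul_eq_zero.1 h0).resolve_right fun h => ?_
    have h2 : ∀ ζ : USphere d, monom (shortlexNth d j) (ζ : Cn d) *
        conj (monom (shortlexNth d j) (ζ : Cn d)) =
        ((‖monom (shortlexNth d j) (ζ : Cn d)‖ ^ 2 : ℝ) : ℂ) := fun ζ => by
      rw [Complex.mul_conj, Complex.normSq_eq_norm_sq]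
    simp only [h2, integral_complex_ofReal] at h
    have h3 : ∫ ζ : USphere d, ‖monom (shortlexNth d j) (ζ : Cn d)‖ ^ 2 ∂(sigma d) = 0 := by
      exact_mod_cast h
    have hc : Continuous fun ζ : USphere d => ‖monom (shortlexNth d j) (ζ : Cn d)‖ ^ 2 :=
      ((continuous_monom _).comp continuous_subtype_val).norm.pow 2
    rw [integral_eq_zero_iff_of_nonneg (fun ζ => by positivity)
      (integrable_of_continuous_sphere _ hc)] at h3
    obtain ⟨ζ, h4, h5⟩ := (h3.and (ae_monom_ne_zero (shortlexNth d j))).exists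
    simp only [Pi.zero_apply, sq_eq_zero_iff, norm_eq_zero] at h4
    exact h5 h4
  · intro i _ hij
    rw [integral_monom_mul_conj_monom, mul_zero]
    rw [shortlexNth_eq, shortlexNth_eq]
    exact fun h => hij ((shortlexEquiv d).symm.injective h).symm
  · exact fun h => absurd hj h

variable (μ) in
/-- The normalised moment vectors. -/
def unitMomentVector (n : ℕ) : Lp ℂ 2 μ :=
  ((‖momentVector μ n‖ : ℂ))⁻¹ • momentVector μ n

lemma norm_momentVector_ne_zero (hσ : sigma d ≪ μ) (n : ℕ) : (‖momentVector μ n‖ : ℂ) ≠ 0 := by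
  have := (linearIndependent_momentVector hσ).ne_zero n
  exact_mod_cast norm_ne_zero_iff.2 this

lemma norm_unitMomentVector (hσ : sigma d ≪ μ) (n : ℕ) : ‖unitMomentVector μ n‖ = 1 := by
  have := norm_momentVector_ne_zero hσ n
  rw [unitMomentVector, norm_smul, norm_inv, Complex.norm_real, norm_norm]
  exact inv_mul_cancel₀ (by exact_mod_cast this)

lemma linearIndependent_unitMomentVector (hσ : sigma d ≪ μ) :
    LinearIndependent ℂ (unitMomentVector μ) :=
  (linearIndependent_momentVector hσ).units_smul
    fun n => (Units.mk0 _ (norm_momentVector_ne_zero hσ n))⁻¹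

variable (μ) in
lemma unitMomentVector_zero : unitMomentVector μ 0 = ContinuousMap.toLp 2 μ ℂ 1 := by
  have h : momentVector μ 0 = ContinuousMap.toLp 2 μ ℂ 1 := by
    rw [momentVector, shortlexNth_zero]
    congr 1
    ext ζ
    simp [conjMonom, monom]
  have h1 : ‖momentVector μ 0‖ = 1 := by
    have := norm_toLp_sq μ 1
    rw [← h] at this
    simp only [ContinuousMap.one_apply, norm_one, one_pow, integral_const, probReal_univ,
      smul_eq_mul, mul_one] at this
    exact (pow_eq_one_iff_of_nonneg (norm_nonneg _) two_ne_zero).1 this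
  rw [unitMomentVector, h1, h]
  simp

variable (μ) in
/-- The moment kernel, transported to `ℕ`. -/
def momentKernelNat (n m : ℕ) : ℂ := momentKernel μ (shortlexNth d n) (shortlexNth d m)

/-- The square roots of the diagonal entries of the moment kernel are the norms of the moment
vectors, so normalising the kernel amounts to normalising the vectors. -/
lemma schurParam_momentKernelNat (hσ : sigma d ≪ μ) (n : ℕ) :
    schurParam (momentKernelNat μ) 0 (n + 1) = partialCorrelation (unitMomentVector μ) 0 n := by
  have := schurParam_eq_partialCorrelation (norm_unitMomentVector hσ)
    (linearIndependent_unitMomentVector hσ) (momentKernelNat μ) (fun k j => ?_) 0 n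
  · rwa [zero_add] at this
  · have hdiag : ∀ k, Real.sqrt (momentKernelNat μ k k).re = ‖momentVector μ k‖ := by
      intro k
      rw [momentKernelNat, ← inner_momentVector, inner_self_eq_norm_sq_to_K]
      norm_cast
      exact Real.sqrt_sq (norm_nonneg _)
    rw [hdiag, hdiag, momentKernelNat, ← inner_momentVector, unitMomentVector, unitMomentVector,
      inner_smul_left, inner_smul_right, map_inv₀, Complex.conj_ofReal]
    push_cast
    rw [div_eq_mul_inv, mul_inv]
    ring

/-- Index `0`, the constant monomial, is left out of the span. Scalars are conjugated because the
vectors are conjugates of polynomials. -/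
lemma exists_polynomial_of_mem_span {n : ℕ} {x : Lp ℂ 2 μ}
    (hx : x ∈ Submodule.span ℂ (unitMomentVector μ '' Set.Ioc 0 n)) :
    ∃ p ∈ polySpan d, ∃ f : C(USphere d, ℂ), (∀ ζ : USphere d, f ζ = conj (p ζ)) ∧
      x = ContinuousMap.toLp 2 μ ℂ f := by
  induction hx using Submodule.span_induction with
  | mem x hx =>
    obtain ⟨m, hm, rfl⟩ := hx
    refine ⟨((‖momentVector μ m‖ : ℂ))⁻¹ • monom (shortlexNth d m),
      Submodule.smul_mem _ _ (Submodule.subset_span ⟨_, fun h => ?_, rfl⟩),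
      ((‖momentVector μ m‖ : ℂ))⁻¹ • conjMonom (shortlexNth d m), fun ζ => ?_, ?_⟩
    · rw [← shortlexNth_zero, shortlexNth_eq, shortlexNth_eq] at h
      exact hm.1.ne' ((shortlexEquiv d).symm.injective h)
    · simp [conjMonom]
    · rw [map_smul]; rfl
  | zero => exact ⟨0, Submodule.zero_mem _, 0, by simp, by simp⟩
  | add x y _ _ hx hy =>
    obtain ⟨p, hp, f, hf, rfl⟩ := hx
    obtain ⟨q, hq, k, hk, rfl⟩ := hy
    exact ⟨p + q, Submodule.add_mem _ hp hq, f + k, fun ζ => by simp [hf, hk], (map_add _ _ _).symm⟩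
  | smul c x _ hx =>
    obtain ⟨p, hp, f, hf, rfl⟩ := hx
    exact ⟨conj c • p, Submodule.smul_mem _ _ hp, c • f, fun ζ => by simp [hf],
      (map_smul _ _ _).symm⟩

lemma exists_mem_span_of_polynomial (hσ : sigma d ≪ μ) {p : Cn d → ℂ} (hp : p ∈ polySpan d) :
    ∃ n, ∃ f : C(USphere d, ℂ), (∀ ζ : USphere d, f ζ = conj (p ζ)) ∧
      ContinuousMap.toLp 2 μ ℂ f ∈ Submodule.span ℂ (unitMomentVector μ '' Set.Ioc 0 n) := by
  have hmono : ∀ {m n : ℕ}, m ≤ n → Submodule.span ℂ (unitMomentVector μ '' Set.Ioc 0 m) ≤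
      Submodule.span ℂ (unitMomentVector μ '' Set.Ioc 0 n) := fun h =>
    Submodule.span_mono (Set.image_mono (Set.Ioc_subset_Ioc_right h))
  induction hp using Submodule.span_induction with
  | mem p hp =>
    obtain ⟨α, hα, rfl⟩ := hp
    set m := shortlexEquiv d α with hm
    have hm' : shortlexNth d m = α := by rw [shortlexNth_eq, hm, Equiv.symm_apply_apply]
    refine ⟨m, conjMonom α, fun ζ => rfl, ?_⟩
    have h1 : ContinuousMap.toLp 2 μ ℂ (conjMonom α) =
        (‖momentVector μ m‖ : ℂ) • unitMomentVector μ m := by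
      rw [unitMomentVector, smul_inv_smul₀ (norm_momentVector_ne_zero hσ m), momentVector, hm']
    rw [h1]
    refine Submodule.smul_mem _ _ (Submodule.subset_span ⟨m, ⟨Nat.pos_of_ne_zero fun h => hα ?_,
      le_rfl⟩, rfl⟩)
    rw [← hm', h, shortlexNth_zero]
  | zero => exact ⟨0, 0, by simp, by simp⟩
  | add p q _ _ hp hq =>
    obtain ⟨m, f, hf, hfm⟩ := hp
    obtain ⟨n, k, hk, hkn⟩ := hq
    refine ⟨max m n, f + k, fun ζ => by simp [hf, hk], ?_⟩
    rw [map_add]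
    exact Submodule.add_mem _ (hmono (le_max_left _ _) hfm) (hmono (le_max_right _ _) hkn)
  | smul c p _ hp =>
    obtain ⟨m, f, hf, hfm⟩ := hp
    refine ⟨m, conj c • f, fun ζ => by simp [hf], ?_⟩
    rw [map_smul]
    exact Submodule.smul_mem _ _ hfm

/-- The partial products are squared distances of `1` to polynomials without constant term:
they are attained. -/
lemma exists_polynomial_integral_eq_prod (hσ : sigma d ≪ μ) (n : ℕ) :
    ∃ p ∈ polySpan d, ∫ ζ : USphere d, ‖1 + p ζ‖ ^ 2 ∂μ =
      ∏ m ∈ Finset.range n, (1 - ‖schurParam (momentKernelNat μ) 0 (m + 1)‖ ^ 2) := by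
  obtain ⟨x, hx, hxn⟩ := exists_norm_sub_sq_eq_prod (norm_unitMomentVector hσ)
    (linearIndependent_unitMomentVector hσ) n
  obtain ⟨p, hp, f, hf, rfl⟩ := exists_polynomial_of_mem_span hx
  refine ⟨-p, Submodule.neg_mem _ hp, ?_⟩
  simp only [schurParam_momentKernelNat hσ]
  rw [← hxn, unitMomentVector_zero, ← map_sub, norm_toLp_sq]
  refine integral_congr_ae (.of_forall fun ζ => ?_)
  have : (1 - f) ζ = conj (1 + (-p) (ζ : Cn d)) := by
    simp [hf, sub_eq_add_neg]
  simp only [this, Complex.norm_conj]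

/-- The partial products are eventually bounded by the squared norm of `1 + p`. -/
lemma exists_prod_le_integral (hσ : sigma d ≪ μ) {p : Cn d → ℂ} (hp : p ∈ polySpan d) :
    ∃ n, ∏ m ∈ Finset.range n, (1 - ‖schurParam (momentKernelNat μ) 0 (m + 1)‖ ^ 2) ≤
      ∫ ζ : USphere d, ‖1 + p ζ‖ ^ 2 ∂μ := by
  obtain ⟨n, f, hf, hfn⟩ := exists_mem_span_of_polynomial hσ (Submodule.neg_mem _ hp)
  refine ⟨n, ?_⟩
  have := prod_le_norm_sub_sq (norm_unitMomentVector hσ)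
    (linearIndependent_unitMomentVector hσ) n _ hfn
  simp only [schurParam_momentKernelNat hσ]
  refine this.trans_eq ?_
  rw [unitMomentVector_zero, ← map_sub, norm_toLp_sq]
  refine integral_congr_ae (.of_forall fun ζ => ?_)
  have : (1 - f) ζ = conj (1 + p (ζ : Cn d)) := by
    simp [hf]
  simp only [this, Complex.norm_conj]

/-- The product of the defects of the Verblunsky coefficients is the squared distance of `1` to the
polynomials without constant term. -/
theorem hasProd_verblunsky (hσ : sigma d ≪ μ) {L : ℝ}
    (hL : ∀ p ∈ polySpan d, L ≤ ∫ ζ : USphere d, ‖1 + p ζ‖ ^ 2 ∂μ)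
    (hL' : ∀ η > 0, ∃ p ∈ polySpan d, ∫ ζ : USphere d, ‖1 + p ζ‖ ^ 2 ∂μ < L + η) :
    HasProd (fun α : Fin d → ℕ => 1 - ‖verblunsky μ 0 α‖ ^ 2) L := by
  set F : ℕ → ℝ := fun n => 1 - ‖schurParam (momentKernelNat μ) 0 n‖ ^ 2 with hF
  have hcomp : (fun α : Fin d → ℕ => 1 - ‖verblunsky μ 0 α‖ ^ 2) = F ∘ shortlexEquiv d := by
    funext α
    rw [verblunsky, shortlexPos_zero]
    rfl
  rw [hcomp, (shortlexEquiv d).hasProd_iff]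
  -- Since `γ_{0,0} = 0`, the index `0` contributes a factor `1`; this accounts for the shift by one
  -- in the partial products.
  have hF0 : F 0 = 1 := by simp [hF, schurParam, schurTable]
  have hlt : ∀ n, ‖schurParam (momentKernelNat μ) 0 (n + 1)‖ < 1 := fun n => by
    rw [schurParam_momentKernelNat hσ]
    exact norm_partialCorrelation_lt_one (norm_unitMomentVector hσ)
      (linearIndependent_unitMomentVector hσ) 0 n
  have hpos : ∀ n, 0 ≤ F n := by
    rintro (_ | n)
    · rw [hF0]; exact zero_le_one
    · have := hlt n
      simp only [hF]
      nlinarith [norm_nonneg (schurParam (momentKernelNat μ) 0 (n + 1))]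
  have hle : ∀ n, F n ≤ 1 := fun n => by
    simp only [hF]
    linarith [sq_nonneg ‖schurParam (momentKernelNat μ) 0 n‖]
  have hprod : ∀ n, ∏ i ∈ Finset.range (n + 1), F i =
      ∏ m ∈ Finset.range n, (1 - ‖schurParam (momentKernelNat μ) 0 (m + 1)‖ ^ 2) := fun n => by
    rw [Finset.prod_range_succ', hF0, mul_one]
  have hge : ∀ n, L ≤ ∏ i ∈ Finset.range (n + 1), F i := fun n => by
    obtain ⟨p, hp, h⟩ := exists_polynomial_integral_eq_prod hσ n
    rw [hprod, ← h]
    exact hL p hp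
  refine hasProd_of_forall_le_of_exists_lt hpos hle (fun n => ?_) fun η hη => ?_
  · rcases n with _ | n
    · simpa [hF0] using hge 0
    · exact hge n
  · obtain ⟨p, hp, h⟩ := hL' η hη
    obtain ⟨n, hn⟩ := exists_prod_le_integral hσ hp
    exact ⟨n + 1, by rw [hprod]; exact hn.trans_lt h⟩

end Moments

end

/-! ### Proof of the theorem -/

theorem mainTheorem11 (d : ℕ) (g : Cn d → ℂ)
    (hg : DifferentiableOn ℂ g (ball 0 1))
    (hg_norm : ∀ z ∈ ball (0 : Cn d) 1, ‖g z‖ ≤ 1)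
    (hg_re : ∀ z ∈ ball (0 : Cn d) 1, 0 ≤ (g z).re)
    (w : USphere d → ℝ) (hw : ∀ ζ, w ζ = ‖boundaryValue g ζ‖ ^ 2)
    (ε : ℝ) (hε : 0 < ε) (hwε : ∀ᵐ ζ ∂(sigma d), ε ≤ w ζ)
    (μs : Measure (USphere d)) (hμs : IsDiscreteMeasure μs)
    (μ : Measure (USphere d)) [IsProbabilityMeasure μ]
    (hμ : μ = (sigma d).withDensity (fun ζ => ENNReal.ofReal (w ζ)) + μs) :
    Integrable (fun ζ => Real.log (w ζ)) (sigma d) ∧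
      HasProd (fun α : Fin d → ℕ => 1 - ‖verblunsky μ 0 α‖ ^ 2)
        (Real.exp (∫ ζ, Real.log (w ζ) ∂(sigma d))) ∧
      0 < Real.exp (∫ ζ, Real.log (w ζ) ∂(sigma d)) := by
  -- For `d = 0` the sphere is empty and carries no probability measure.
  have : NeZero d := by
    refine ⟨?_⟩
    rintro rfl
    obtain ⟨ζ⟩ := μ.nonempty_of_neZero
    have h1 : (ζ : Cn 0) = 0 := Subsingleton.elim _ _
    have h2 := norm_coe_sphere ζ
    simp [h1] at h2
  set gs : USphere d → ℂ := boundaryValue g with hgs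
  have hsq : 0 < Real.sqrt ε := Real.sqrt_pos.2 hε
  have hlow : ∀ᵐ ζ ∂(sigma d), Real.sqrt ε ≤ ‖gs ζ‖ := by
    filter_upwards [hwε] with ζ h
    rw [hw] at h
    exact Real.sqrt_le_iff.2 ⟨norm_nonneg _, h⟩
  have hlim : ∀ᵐ ζ : USphere d ∂(sigma d),
      Tendsto (fun n => g ((radius n : ℂ) • (ζ : Cn d))) atTop (𝓝 (gs ζ)) := by
    filter_upwards [hlow] with ζ h
    exact (hasKLimit_boundaryValue (norm_pos_iff.1 (hsq.trans_le h))).tendsto_radial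
  have hn : ∀ᵐ ζ ∂(sigma d), ‖gs ζ‖ ≤ 1 := by
    filter_upwards [hlim] with ζ h
    exact le_of_tendsto' h.norm fun n =>
      hg_norm _ (radius_smul_mem_ball n (sphere_mem_closedBall ζ))
  have hre : ∀ᵐ ζ ∂(sigma d), 0 ≤ (gs ζ).re := by
    filter_upwards [hlim] with ζ h
    exact ge_of_tendsto' ((Complex.continuous_re.tendsto _).comp h) fun n =>
      hg_re _ (radius_smul_mem_ball n (sphere_mem_closedBall ζ))
  have hgsm : AEMeasurable gs (sigma d) := aemeasurable_of_radialLimit hg hlim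
  have hwm : AEMeasurable w (sigma d) := by
    rw [show w = fun ζ => ‖gs ζ‖ ^ 2 from funext hw]
    exact hgsm.norm.pow_const 2
  -- This holds also where the boundary value is `0`, as `Real.log 0 = 0`.
  have hlog : ∀ ζ, Real.log (w ζ) = 2 * Real.log ‖gs ζ‖ := fun ζ => by
    rw [hw, Real.log_pow]; norm_num
  have hint : Integrable (fun ζ => Real.log (w ζ)) (sigma d) := by
    refine Integrable.of_bound (Real.measurable_log.comp_aemeasurable hwm).aestronglyMeasurable
      |Real.log ε| ?_
    filter_upwards [hwε, hn] with ζ h1 h2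
    have h3 : w ζ ≤ 1 := by rw [hw]; exact pow_le_one₀ (norm_nonneg _) h2
    have h4 := Real.log_le_log hε h1
    have h5 := Real.log_nonpos (hε.le.trans h1) h3
    rw [Real.norm_eq_abs, abs_of_nonpos h5]
    linarith [neg_abs_le (Real.log ε)]
  have hexp : Real.exp (∫ ζ, Real.log (w ζ) ∂(sigma d)) = ‖g 0‖ ^ 2 := by
    simp only [hlog]
    rw [integral_const_mul, ← exp_integral_log_norm hg hg_norm hg_re hlim hre hn hsq hlow,
      ← Real.exp_nat_mul]
    norm_num
  refine ⟨hint, ?_, Real.exp_pos _⟩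
  rw [hexp]
  have hwo : AEMeasurable (fun ζ => ENNReal.ofReal (w ζ)) (sigma d) := hwm.ennreal_ofReal
  have hle_w : (sigma d).withDensity (fun ζ => ENNReal.ofReal (w ζ)) ≤ μ := by
    rw [hμ]; exact Measure.le_add_right le_rfl
  have hle_s : μs ≤ μ := by
    rw [hμ]; exact Measure.le_add_left le_rfl
  have : IsFiniteMeasure μs := isFiniteMeasure_of_le μ hle_s
  have : IsFiniteMeasure ((sigma d).withDensity (fun ζ => ENNReal.ofReal (w ζ))) :=
    isFiniteMeasure_of_le μ hle_w
  -- A density that is positive `σ`-a.e. makes `σ` absolutely continuous with respect to `w dσ`,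
  -- which is dominated by `μ`.
  have hσ : sigma d ≪ μ := by
    refine (withDensity_absolutelyContinuous' hwo ?_).trans hle_w.absolutelyContinuous
    filter_upwards [hwε] with ζ h
    exact (ENNReal.ofReal_pos.2 (hε.trans_le h)).ne'
  have hsplit : ∀ f : USphere d → ℝ, Continuous f →
      ∫ ζ, f ζ ∂μ = ∫ ζ, f ζ * ‖gs ζ‖ ^ 2 ∂(sigma d) + ∫ ζ, f ζ ∂μs := by
    intro f hf
    rw [hμ, integral_add_measure (integrable_of_continuous_sphere _ hf)
      (integrable_of_continuous_sphere _ hf), integral_withDensity_eq_integral_toReal_smul₀ hwo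
      (.of_forall fun ζ => ENNReal.ofReal_lt_top)]
    congr 1
    refine integral_congr_ae (.of_forall fun ζ => ?_)
    simp only [hw]
    rw [ENNReal.toReal_ofReal (by positivity), smul_eq_mul, mul_comm]
  refine hasProd_verblunsky hσ (fun p hp => ?_) fun η hη =>
    exists_polynomial_integral_lt hg hg_re hlim hre hn hμs hsplit hη
  have hpc : Continuous fun ζ : USphere d => ‖1 + p ζ‖ ^ 2 :=
    (continuous_const.add
      ((polySpan_spec hp).1.continuous.comp continuous_subtype_val)).norm.pow 2
  -- For the lower bound the singular part only adds a nonnegative term.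
  rw [hsplit _ hpc]
  exact (sq_norm_le_integral hg hg_norm hlim hn hp).trans
    (le_add_of_nonneg_right (integral_nonneg fun ζ => by positivity))
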